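/- Let $d\in\mathbb N$, let $s>d/2$ be real, and let $f:\mathbb{C}\to\mathbb{C}$ be smooth in the real sense (i.e. $C^\infty$ as a map $\mathbb{R}^2\to\mathbb{R}^2$) with $f(0)=0$. Write $f'(z)\in\mathcal{L}_{\mathbb R}(\mathbb{C})$ for the real derivative of $f$ at $z$, and put $\mathsf{H}_1=H^s(\mathbb{R}^d)=H^s(\mathbb{R}^d;\mathbb{C})$ and $\mathsf{H}_0=L^2(\mathbb{R}^d;\mathbb{C})$. Then: (i) $B(u)(x)=f(u(x))$ (for a.e. $x$) is a well-defined map $B:\mathsf{H}_1\to\mathsf{H}_1$, and it is locally Lipschitz in the sense that it is Lipschitz on every ball of $\mathsf{H}_1$ centred at the origin; (ii) $(B'(u)v)(x)=f'(u(x))\,v(x)$ (for a.e. $x$), where $u\in\mathsf{H}_1$ and $v\in\mathsf{H}_0$, is a well-defined map $B':\mathsf{H}_1\to\mathcal{B}(\mathsf{H}_0)$ into the bounded real-linear operators on $\mathsf{H}_0$; (iii) for all $R,\varepsilon>0$ there are $C,\delta>0$ such that, for all $u,w\in\mathsf{H}_1$ with $\|u\|_{\mathsf{H}_1}\le R$ and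 $\|w\|_{\mathsf{H}_1}<\delta$, $$\|B'(u)\|_{\mathcal{B}(\mathsf{H}_0)}\le C,\qquad \|B(u+w)-B(u)-B'(u)w\|_{\mathsf{H}_0}\le\varepsilon\|w\|_{\mathsf{H}_0}.$$ -/

import Mathlib

open MeasureTheory FourierTransform
open scoped ENNReal NNReal ContDiff SchwartzMap

noncomputable section

namespace LocalNonlinearity

/-- `ℝ^d` with its Euclidean structure. -/
abbrev Rd (d : ℕ) : Type := EuclideanSpace ℝ (Fin d)

/-- The Hilbert space `L²(ℝ^d; ℂ)`. -/
abbrev L2 (d : ℕ) : Type := Lp ℂ 2 (volume : Measure (Rd d))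

/-- The function `ξ ↦ (1 + |ξ|²)^{s/2} û(ξ)`, where `û` is the Fourier–Plancherel transform of the
`L²` function `u` (with kernel `e^{-2πi x·ξ}`). -/
def weightedFourierFun (d : ℕ) (s : ℝ) (u : L2 d) : Rd d → ℂ :=
  fun ξ => (((1 + ‖ξ‖ ^ 2) ^ (s / 2) : ℝ) : ℂ) * (𝓕 u : L2 d) ξ

theorem weightedFourierFun_add (d : ℕ) (s : ℝ) (u v : L2 d) :
    weightedFourierFun d s (u + v) =ᵐ[volume]
      weightedFourierFun d s u + weightedFourierFun d s v := by
  have h : (𝓕 (u + v) : L2 d) = 𝓕 u + 𝓕 v := FourierTransform.fourier_add u v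
  filter_upwards [Lp.coeFn_add (𝓕 u : L2 d) (𝓕 v)] with ξ hξ
  simp only [weightedFourierFun, Pi.add_apply, h, hξ]
  ring

theorem weightedFourierFun_smul (d : ℕ) (s : ℝ) (c : ℂ) (u : L2 d) :
    weightedFourierFun d s (c • u) =ᵐ[volume] c • weightedFourierFun d s u := by
  have h : (𝓕 (c • u) : L2 d) = c • 𝓕 u := FourierTransform.fourier_smul c u
  filter_upwards [Lp.coeFn_smul c (𝓕 u : L2 d)] with ξ hξ
  simp only [weightedFourierFun, Pi.smul_apply, h, hξ, smul_eq_mul]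
  ring

theorem weightedFourierFun_zero (d : ℕ) (s : ℝ) :
    weightedFourierFun d s 0 =ᵐ[volume] 0 := by
  simpa using weightedFourierFun_smul d s 0 0

/-- The functions `u ∈ L²(ℝ^d)` with `(1 + |ξ|²)^{s/2} û ∈ L²(ℝ^d)`, as a subspace of `L²`. -/
def sobolevSubmodule (d : ℕ) (s : ℝ) : Submodule ℂ (L2 d) where
  carrier := {u | MemLp (weightedFourierFun d s u) 2 volume}
  zero_mem' := MemLp.zero.ae_eq (weightedFourierFun_zero d s).symm
  add_mem' {u v} hu hv := (MemLp.add hu hv).ae_eq (weightedFourierFun_add d s u v).symm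
  smul_mem' c u hu := (MemLp.const_smul hu c).ae_eq (weightedFourierFun_smul d s c u).symm

theorem memLp_weightedFourierFun {d : ℕ} {s : ℝ} (u : sobolevSubmodule d s) :
    MemLp (weightedFourierFun d s (u : L2 d)) 2 volume := u.2

/-- The linear map `u ↦ (1 + |ξ|²)^{s/2} û` into `L²(ℝ^d)`. -/
def weightedFourier (d : ℕ) (s : ℝ) : sobolevSubmodule d s →ₗ[ℂ] L2 d where
  toFun u := (memLp_weightedFourierFun u).toLp
  map_add' u v := by
    exact (MemLp.toLp_congr _
      ((memLp_weightedFourierFun u).add (memLp_weightedFourierFun v)) (weightedFourierFun_add d s u.1 v.1)).trans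
      (MemLp.toLp_add _ _)
  map_smul' c u := by
    exact (MemLp.toLp_congr _ ((memLp_weightedFourierFun u).const_smul c)
      (weightedFourierFun_smul d s c u.1)).trans (MemLp.toLp_const_smul _ _)

theorem weightedFourier_injective (d : ℕ) (s : ℝ) :
    Function.Injective (weightedFourier d s) := by
  rw [← LinearMap.ker_eq_bot, LinearMap.ker_eq_bot']
  intro u hu
  have h1 : weightedFourierFun d s u.1 =ᵐ[volume] 0 :=
    (MemLp.coeFn_toLp u.2).symm.trans ((Lp.eq_zero_iff_ae_eq_zero).1 hu)
  have h2 : (𝓕 u.1 : L2 d) = 0 := by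
    rw [Lp.eq_zero_iff_ae_eq_zero]
    filter_upwards [h1] with ξ hξ
    have h0 : (((1 + ‖ξ‖ ^ 2) ^ (s / 2) : ℝ) : ℂ) ≠ 0 := by
      rw [Complex.ofReal_ne_zero]
      positivity
    exact (mul_eq_zero.1 hξ).resolve_left h0
  refine Subtype.ext ?_
  rw [ZeroMemClass.coe_zero, ← norm_eq_zero, ← Lp.norm_fourier_eq, h2, norm_zero]

/-- The Sobolev space `H^s(ℝ^d)` of complex-valued functions, for a real order `s ≥ 0`.
Its norm, introduced below, is not the one inherited from `L²`. -/
def Hs (d : ℕ) (s : ℝ) : Type := sobolevSubmodule d s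

instance (d : ℕ) (s : ℝ) : AddCommGroup (Hs d s) :=
  inferInstanceAs (AddCommGroup (sobolevSubmodule d s))

instance (d : ℕ) (s : ℝ) : Module ℂ (Hs d s) :=
  inferInstanceAs (Module ℂ (sobolevSubmodule d s))

/-- The inclusion of `H^s(ℝ^d)` into `L²(ℝ^d)`. -/
def Hs.toL2 {d : ℕ} {s : ℝ} : Hs d s →ₗ[ℂ] L2 d := (sobolevSubmodule d s).subtype

/-- The map `u ↦ (1 + |ξ|²)^{s/2} û` from `H^s(ℝ^d)` to `L²(ℝ^d)`. -/
def Hs.weightedFourier (d : ℕ) (s : ℝ) : Hs d s →ₗ[ℂ] L2 d :=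
  LocalNonlinearity.weightedFourier d s

/-- The norm `‖u‖_{H^s} = ‖(1 + |ξ|²)^{s/2} û‖_{L²}`. -/
instance (d : ℕ) (s : ℝ) : NormedAddCommGroup (Hs d s) :=
  NormedAddCommGroup.induced (Hs d s) (L2 d) (Hs.weightedFourier d s)
    (weightedFourier_injective d s)

/-- The inner product `⟪u, v⟫_{H^s} = ⟪(1 + |ξ|²)^{s/2} û, (1 + |ξ|²)^{s/2} v̂⟫_{L²}`. -/
instance (d : ℕ) (s : ℝ) : InnerProductSpace ℂ (Hs d s) :=
  InnerProductSpace.induced (Hs.weightedFourier d s)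

theorem Hs.norm_eq {d : ℕ} {s : ℝ} (u : Hs d s) :
    ‖u‖ = (eLpNorm (weightedFourierFun d s u.toL2) 2 volume).toReal :=
  Lp.norm_toLp _ u.2

/-- Membership agrees with Mathlib's Sobolev condition on the tempered distribution `u`. -/
theorem mem_sobolevSubmodule_iff {d : ℕ} {s : ℝ} {u : L2 d} :
    u ∈ sobolevSubmodule d s ↔ TemperedDistribution.MemSobolev s 2 (u : 𝓢'(Rd d, ℂ)) := by
  have hw : (fun ξ : Rd d => (((1 + ‖ξ‖ ^ 2) ^ (s / 2) : ℝ) : ℂ)).HasTemperateGrowth := by fun_prop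
  have hL : ∀ g : 𝓢(Rd d, ℂ), TemperedDistribution.smulLeftCLM ℂ
      (fun ξ : Rd d => (((1 + ‖ξ‖ ^ 2) ^ (s / 2) : ℝ) : ℂ)) (𝓕 (u : 𝓢'(Rd d, ℂ))) g
      = ∫ ξ, g ξ • weightedFourierFun d s u ξ := by
    intro g
    rw [Lp.fourier_toTemperedDistribution_eq, TemperedDistribution.smulLeftCLM_apply_apply,
      Lp.toTemperedDistribution_apply]
    refine integral_congr_ae (Filter.Eventually.of_forall fun ξ => ?_)
    simp only [SchwartzMap.smulLeftCLM_apply_apply hw, weightedFourierFun, smul_eq_mul]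
    ring
  rw [TemperedDistribution.memSobolev_iff_exists_smulLeftCLM_fourier]
  constructor
  · intro hu
    refine ⟨MemLp.toLp _ hu, ?_⟩
    ext g
    rw [hL, Lp.toTemperedDistribution_apply]
    refine integral_congr_ae ?_
    filter_upwards [MemLp.coeFn_toLp hu] with ξ hξ
    rw [hξ]
  · rintro ⟨v, hv⟩
    have hloc : LocallyIntegrable (weightedFourierFun d s u) volume := by
      have h2 : LocallyIntegrable (𝓕 u : L2 d) volume :=
        (Lp.memLp (𝓕 u : L2 d)).locallyIntegrable (by norm_num)
      have h4 := (locallyIntegrableOn_univ.2 h2).continuousOn_mul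
        hw.1.continuous.continuousOn isOpen_univ.isLocallyClosed
      exact locallyIntegrableOn_univ.1 h4
    have hae : ∀ᵐ ξ ∂volume, weightedFourierFun d s u ξ = v ξ := by
      refine ae_eq_of_integral_contDiff_smul_eq hloc
        ((Lp.memLp v).locallyIntegrable (by norm_num)) fun g hg hgc => ?_
      have hg₁ : HasCompactSupport (Complex.ofRealCLM ∘ g) := hgc.comp_left rfl
      have hg₂ : ContDiff ℝ ∞ (Complex.ofRealCLM ∘ g) := by fun_prop
      have h3 := congrArg (fun T : 𝓢'(Rd d, ℂ) => T (hg₁.toSchwartzMap hg₂)) hv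
      simp only [hL, Lp.toTemperedDistribution_apply] at h3
      simpa using h3
    exact (Lp.memLp v).ae_eq (Filter.EventuallyEq.symm hae)

end LocalNonlinearity

end

/-!
On the range of a ball of `H^s`, which is bounded since `s > d/2`, the nonlinearity agrees with a
Schwartz function `g`. Fourier inversion of `g` writes `g ∘ u - g(0)` as the superposition
`∫ ĝ(ζ) (e^{2πi⟨u, ζ⟩} - 1) dζ`, so it suffices that the Lipschitz constant on balls of
`φ ↦ e^φ - 1`, for imaginary-valued `φ ∈ H^s`, grows at most polynomially in `‖φ‖`. The algebra
property of `H^s` only gives exponential growth. However, multiplication by the unimodular function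
`e^φ` is isometric on `L²` and increases the `H^s` norm only through its commutator with
`(1 + |ξ|²)^{s/2}`, which is of lower order. Applying this to the `n` factors of
`e^φ = (e^{φ/n})^n`, interpolating the lower order norm between `H^s` and `L²`, and using Grönwall's
inequality gives polynomial growth.

The statements about `B'` follow from the embedding of `H^s` into the bounded functions, since `f`
has a Taylor expansion of first order which is uniform on compact sets.
-/

noncomputable section

namespace LocalNonlinearity

section Weight

variable {E : Type*} [NormedAddCommGroup E]

/-- The weight `(1 + |ξ|²)^{s/2}` of order `s` that defines the `H^s` norm. -/
def weight (s : ℝ) (ξ : E) : ℝ := (1 + ‖ξ‖ ^ 2) ^ (s / 2)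

theorem weight_pos (s : ℝ) (ξ : E) : 0 < weight s ξ := by
  unfold weight; positivity

theorem weight_mul (s t : ℝ) (ξ : E) : weight s ξ * weight t ξ = weight (s + t) ξ := by
  unfold weight
  rw [← Real.rpow_add (by positivity), add_div]

@[simp] theorem weight_zero (ξ : E) : weight 0 ξ = 1 := by simp [weight]

theorem weight_mono {s t : ℝ} (h : s ≤ t) (ξ : E) : weight s ξ ≤ weight t ξ :=
  Real.rpow_le_rpow_of_exponent_le (by nlinarith [sq_nonneg ‖ξ‖]) (by linarith)

theorem one_le_weight {s : ℝ} (hs : 0 ≤ s) (ξ : E) : 1 ≤ weight s ξ := by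
  simpa only [weight_zero] using weight_mono hs ξ

theorem weight_one_rpow (s : ℝ) (ξ : E) : weight 1 ξ ^ s = weight s ξ := by
  unfold weight
  rw [← Real.rpow_mul (by positivity)]
  ring_nf

theorem weight_one_sq (ξ : E) : weight 1 ξ ^ 2 = 1 + ‖ξ‖ ^ 2 := by
  rw [sq, weight_mul]
  norm_num [weight]

theorem weight_neg (s : ℝ) (ξ : E) : weight s (-ξ) = weight s ξ := by
  simp only [weight, norm_neg]

@[fun_prop] theorem continuous_weight (s : ℝ) : Continuous (weight s : E → ℝ) := by
  unfold weight
  exact Continuous.rpow_const (by fun_prop) fun ξ => Or.inl (by positivity)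

theorem abs_weight_one_sub_le (ξ η : E) : |weight 1 ξ - weight 1 η| ≤ weight 1 (ξ - η) := by
  have hprod : 1 + ‖ξ‖ * ‖η‖ ≤ weight 1 ξ * weight 1 η := by
    refine le_of_sq_le_sq ?_ (mul_pos (weight_pos 1 ξ) (weight_pos 1 η)).le
    rw [mul_pow, weight_one_sq, weight_one_sq]
    nlinarith [sq_nonneg (‖ξ‖ - ‖η‖)]
  have hnorm : (‖ξ‖ - ‖η‖) ^ 2 ≤ ‖ξ - η‖ ^ 2 :=
    sq_le_sq' (by linarith [abs_le.1 (abs_norm_sub_norm_le ξ η)]) (norm_sub_norm_le ξ η)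
  refine le_of_sq_le_sq ?_ (weight_pos 1 _).le
  rw [sq_abs, sub_sq, weight_one_sq, weight_one_sq, weight_one_sq]
  nlinarith

theorem exists_abs_rpow_sub_one_le {s : ℝ} (hs : 0 < s) :
    ∃ K : ℝ≥0, ∀ t : ℝ, 0 ≤ t → t ≤ 2 → |t ^ s - 1| ≤ K * |t - 1| := by
  obtain ⟨N, hN⟩ := exists_nat_ge s
  refine ⟨N * 2 ^ (N - 1), fun t ht ht2 => ?_⟩
  push_cast
  have hpow : |t ^ N - 1| ≤ N * 2 ^ (N - 1) * |t - 1| := by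
    have h := abs_pow_sub_pow_le t 1 N
    rw [one_pow, abs_one, abs_of_nonneg ht] at h
    calc |t ^ N - 1| ≤ |t - 1| * N * max t 1 ^ (N - 1) := h
      _ ≤ |t - 1| * N * 2 ^ (N - 1) := by gcongr; exact max_le ht2 one_le_two
      _ = N * 2 ^ (N - 1) * |t - 1| := by ring
  refine le_trans ?_ hpow
  rw [← Real.rpow_natCast]
  rcases le_total 1 t with h | h
  · rw [abs_of_nonneg (by linarith [Real.one_le_rpow h hs.le]),
      abs_of_nonneg (by linarith [Real.one_le_rpow h (hs.le.trans hN)])]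
    linarith [Real.rpow_le_rpow_of_exponent_le h hN]
  · rw [abs_of_nonpos (by linarith [Real.rpow_le_one ht h hs.le]),
      abs_of_nonpos (by linarith [Real.rpow_le_one ht h (hs.le.trans hN)])]
    linarith [Real.rpow_le_rpow_of_exponent_ge' ht h hs.le hN]

theorem abs_rpow_sub_rpow_le_of_le {s x y z : ℝ} (hs : 0 < s) (hx : 0 ≤ x) (hy : 0 ≤ y)
    (hxy : |x - y| ≤ z) (hyz : y ≤ z) : |x ^ s - y ^ s| ≤ 2 ^ s * z ^ s := by
  have hz : 0 ≤ z := hy.trans hyz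
  rw [← Real.mul_rpow zero_le_two hz, abs_sub_le_iff]
  have hxz : x ^ s ≤ (2 * z) ^ s := by
    gcongr
    linarith [(abs_le.1 hxy).2]
  have hyz : y ^ s ≤ (2 * z) ^ s := by
    gcongr
    linarith
  constructor <;> linarith [Real.rpow_nonneg hx s, Real.rpow_nonneg hy s]

theorem exists_abs_rpow_sub_rpow_le_of_ge {s ρ : ℝ} (hs : 0 < s) (hsρ : s - 1 ≤ ρ) :
    ∃ K : ℝ≥0, ∀ x y z : ℝ, 0 ≤ x → 0 < z → |x - y| ≤ z → z ≤ y →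
      |x ^ s - y ^ s| ≤ K * (z ^ (s - ρ) * y ^ ρ) := by
  obtain ⟨K, hKt⟩ := exists_abs_rpow_sub_one_le hs
  refine ⟨K, fun x y z hx hz hxy hzy => ?_⟩
  have hy : 0 < y := hz.trans_le hzy
  have hratio : |(x / y) ^ s - 1| ≤ K * (z / y) := by
    refine (hKt (x / y) (by positivity) ?_).trans ?_
    · rw [div_le_iff₀ hy]
      linarith [(abs_le.1 hxy).2]
    · rw [div_sub_one hy.ne', abs_div, abs_of_pos hy]
      gcongr
  have hzpow : z / y ≤ (z / y) ^ (s - ρ) := by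
    simpa only [Real.rpow_one] using
      Real.rpow_le_rpow_of_exponent_ge (by positivity) ((div_le_one hy).2 hzy)
        (by linarith : s - ρ ≤ 1)
  calc |x ^ s - y ^ s| = |(x / y) ^ s - 1| * y ^ s := by
        have hys : 0 < y ^ s := Real.rpow_pos_of_pos hy s
        rw [Real.div_rpow hx hy.le, ← abs_of_pos hys, ← abs_mul, abs_of_pos hys, sub_mul,
          div_mul_cancel₀ _ hys.ne', one_mul]
    _ ≤ K * (z / y) ^ (s - ρ) * y ^ s := by
        gcongr
        exact hratio.trans (by gcongr)
    _ = K * (z ^ (s - ρ) * y ^ ρ) := by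
        rw [Real.div_rpow hz.le hy.le, Real.rpow_sub hy s ρ]
        field_simp

theorem exists_abs_weight_sub_le {s ρ : ℝ} (hs : 0 < s) (hsρ : s - 1 ≤ ρ) :
    ∃ C : ℝ≥0, ∀ ξ η : E, |weight s ξ - weight s η| ≤
      C * (weight s (ξ - η) + weight (s - ρ) (ξ - η) * weight ρ η) := by
  obtain ⟨K, hKle⟩ := exists_abs_rpow_sub_rpow_le_of_ge hs hsρ
  refine ⟨2 ^ s + K, fun ξ η => ?_⟩
  have hlow := weight_pos s (ξ - η)
  have hhigh := mul_pos (weight_pos (s - ρ) (ξ - η)) (weight_pos ρ η)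
  have htwo : (0 : ℝ) < 2 ^ s := by positivity
  rw [← weight_one_rpow s] at hlow
  rw [← weight_one_rpow (s - ρ), ← weight_one_rpow ρ] at hhigh
  rw [← weight_one_rpow s, ← weight_one_rpow s η, ← weight_one_rpow s (ξ - η),
    ← weight_one_rpow (s - ρ), ← weight_one_rpow ρ]
  push_cast
  rcases le_total (weight 1 η) (weight 1 (ξ - η)) with h | h
  · have := abs_rpow_sub_rpow_le_of_le hs (weight_pos 1 ξ).le (weight_pos 1 η).le
      (abs_weight_one_sub_le ξ η) h
    nlinarith [mul_nonneg K.2 hlow.le, mul_nonneg K.2 hhigh.le, mul_pos htwo hhigh]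
  · have := hKle _ _ _ (weight_pos 1 ξ).le (weight_pos 1 (ξ - η)) (abs_weight_one_sub_le ξ η) h
    nlinarith [mul_nonneg K.2 hlow.le, mul_pos htwo hlow, mul_pos htwo hhigh]

theorem exists_weight_le_mul_add_pow (E : Type*) [NormedAddCommGroup E] {ρ s : ℝ} (h : ρ < s) :
    ∃ m : ℕ, ∀ (ξ : E) (ε : ℝ), 0 < ε → weight ρ ξ ≤ ε * weight s ξ + ε⁻¹ ^ m := by
  obtain ⟨m, hm⟩ := exists_nat_ge (ρ / (s - ρ))
  refine ⟨m, fun ξ ε hε => ?_⟩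
  have hpos := weight_pos 1 ξ
  have hsplit : weight s ξ = weight (s - ρ) ξ * weight ρ ξ := by rw [weight_mul, sub_add_cancel]
  rcases le_total ε⁻¹ (weight (s - ρ) ξ) with hlarge | hsmall
  · have : 1 ≤ ε * weight (s - ρ) ξ := by rwa [← inv_le_iff_one_le_mul₀' hε]
    have := weight_pos ρ ξ
    have : 0 ≤ ε⁻¹ ^ m := by positivity
    rw [hsplit]
    nlinarith
  · have : weight ρ ξ ≤ ε⁻¹ ^ m := by
      calc weight ρ ξ = weight (s - ρ) ξ ^ (ρ / (s - ρ)) := by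
            rw [← weight_one_rpow (s - ρ), ← Real.rpow_mul hpos.le,
              mul_div_cancel₀ _ (sub_pos.2 h).ne', weight_one_rpow]
        _ ≤ weight (s - ρ) ξ ^ (m : ℝ) :=
            Real.rpow_le_rpow_of_exponent_le (one_le_weight (sub_pos.2 h).le ξ) hm
        _ ≤ ε⁻¹ ^ m := by
            rw [Real.rpow_natCast]
            exact pow_le_pow_left₀ (weight_pos _ ξ).le hsmall m
    have := mul_pos hε (weight_pos s ξ)
    linarith

theorem memLp_weight_neg [InnerProductSpace ℝ E] [FiniteDimensional ℝ E] [MeasurableSpace E]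
    [BorelSpace E] {r : ℝ} (hr : (Module.finrank ℝ E : ℝ) / 2 < r) :
    MemLp (weight (-r) : E → ℝ) 2 volume := by
  rw [memLp_two_iff_integrable_sq (continuous_weight _).aestronglyMeasurable]
  refine (integrable_rpow_neg_one_add_norm_sq (μ := volume)
    (by linarith : (Module.finrank ℝ E : ℝ) < 2 * r)).congr (ae_of_all _ fun ξ => ?_)
  simp only [sq (weight (-r) ξ), weight_mul]
  unfold weight
  ring_nf

end Weight

section Young

variable {G : Type*} [AddCommGroup G] [MeasurableSpace G] {μ : Measure G}
  {𝕜 F₁ F₂ F₃ : Type*} [NontriviallyNormedField 𝕜] [NormedAddCommGroup F₁]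
  [NormedAddCommGroup F₂] [NormedAddCommGroup F₃] [NormedSpace 𝕜 F₁] [NormedSpace 𝕜 F₂]
  [NormedSpace 𝕜 F₃] (L : F₁ →L[𝕜] F₂ →L[𝕜] F₃)

theorem lintegral_enorm_convolution_integrand_le (f : G → F₁) (g : G → F₂) (x : G) :
    ∫⁻ t, ‖L (f t) (g (x - t))‖ₑ ∂μ ≤ ‖L‖ₑ * ((‖f ·‖ₑ) ⋆ₗ[μ] (‖g ·‖ₑ)) x := by
  rw [lconvolution_def, ← lintegral_const_mul' _ _ enorm_ne_top]
  refine lintegral_mono fun t => ?_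
  rw [neg_add_eq_sub, ← mul_assoc]
  exact (L (f t)).le_opENorm _ |>.trans (by gcongr; exact L.le_opENorm _)

theorem enorm_convolution_le [NormedSpace ℝ F₃] (f : G → F₁) (g : G → F₂) (x : G) :
    ‖convolution f g L μ x‖ₑ ≤ ‖L‖ₑ * ((‖f ·‖ₑ) ⋆ₗ[μ] (‖g ·‖ₑ)) x :=
  (enorm_integral_le_lintegral_enorm _).trans (lintegral_enorm_convolution_integrand_le L f g x)

variable [MeasurableAdd₂ G] [MeasurableNeg G] [SFinite μ] [μ.IsAddLeftInvariant]
  {f : G → F₁} {g : G → F₂}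

theorem lintegral_lconvolution {f g : G → ℝ≥0∞} (hf : AEMeasurable f μ) (hg : AEMeasurable g μ) :
    ∫⁻ x, (f ⋆ₗ[μ] g) x ∂μ = (∫⁻ x, f x ∂μ) * ∫⁻ x, g x ∂μ := by
  simp only [lconvolution_def]
  rw [lintegral_lintegral_swap (by fun_prop), ← lintegral_mul_const'' _ hf]
  refine lintegral_congr fun y => ?_
  have hgy : AEMeasurable (fun x => g (-y + x)) μ := hg.comp_quasiMeasurePreserving
    (measurePreserving_add_left μ (-y)).quasiMeasurePreserving
  rw [lintegral_const_mul'' _ hgy, lintegral_add_left_eq_self]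

theorem lconvolution_rpow_le {p : ℝ} (hp : 1 ≤ p) {f g : G → ℝ≥0∞} (hf : AEMeasurable f μ)
    (hg : AEMeasurable g μ) (x : G) :
    (f ⋆ₗ[μ] g) x ^ p ≤ (∫⁻ y, f y ∂μ) ^ (p - 1) * (f ⋆ₗ[μ] fun y => g y ^ p) x := by
  have hp0 : 0 < p := one_pos.trans_le hp
  have hpinv : p⁻¹ ≤ 1 := inv_le_one_of_one_le₀ hp
  have hgx : AEMeasurable (fun y => g (-y + x)) μ := hg.comp_quasiMeasurePreserving
    (by simpa only [neg_add_eq_sub] using quasiMeasurePreserving_sub_left_of_right_invariant μ x)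
  have hsplit (a b : ℝ≥0∞) : a ^ (1 - p⁻¹) * (a * b ^ p) ^ p⁻¹ = a * b := by
    rw [ENNReal.mul_rpow_of_nonneg _ _ (inv_nonneg.2 hp0.le), ← mul_assoc,
      ← ENNReal.rpow_add_of_nonneg _ _ (sub_nonneg.2 hpinv) (inv_nonneg.2 hp0.le),
      ENNReal.rpow_rpow_inv hp0.ne', sub_add_cancel, ENNReal.rpow_one]
  have hHolder := ENNReal.lintegral_mul_norm_pow_le hf (hf.mul (hgx.pow_const p))
    (sub_nonneg.2 hpinv) (inv_nonneg.2 hp0.le) (sub_add_cancel 1 p⁻¹)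
  simp only [Pi.mul_apply, hsplit] at hHolder
  calc (f ⋆ₗ[μ] g) x ^ p
      ≤ ((∫⁻ y, f y ∂μ) ^ (1 - p⁻¹) * (f ⋆ₗ[μ] fun y => g y ^ p) x ^ p⁻¹) ^ p :=
        ENNReal.rpow_le_rpow hHolder hp0.le
    _ = _ := by
        rw [ENNReal.mul_rpow_of_nonneg _ _ hp0.le, ← ENNReal.rpow_mul,
          ENNReal.rpow_inv_rpow hp0.ne', sub_mul, inv_mul_cancel₀ hp0.ne', one_mul]

theorem eLpNorm_lconvolution_le {p : ℝ≥0∞} (hp : 1 ≤ p) (hp_top : p ≠ ⊤) {f g : G → ℝ≥0∞}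
    (hf : AEMeasurable f μ) (hg : AEMeasurable g μ) :
    eLpNorm (f ⋆ₗ[μ] g) p μ ≤ eLpNorm f 1 μ * eLpNorm g p μ := by
  lift p to ℝ≥0 using hp_top
  have hp1 : (1 : ℝ) ≤ p := mod_cast hp
  have hp0 : (0 : ℝ) < p := one_pos.trans_le hp1
  have hp_ne : p ≠ 0 := mod_cast hp0.ne'
  rw [eLpNorm_one_eq_lintegral_enorm, eLpNorm_nnreal_eq_lintegral hp_ne,
    eLpNorm_nnreal_eq_lintegral hp_ne]
  simp only [enorm_eq_self, one_div]
  rw [ENNReal.rpow_inv_le_iff hp0, ENNReal.mul_rpow_of_nonneg _ _ hp0.le,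
    ENNReal.rpow_inv_rpow hp0.ne']
  calc ∫⁻ x, (f ⋆ₗ[μ] g) x ^ (p : ℝ) ∂μ
      ≤ ∫⁻ x, (∫⁻ y, f y ∂μ) ^ (p - 1 : ℝ) * (f ⋆ₗ[μ] fun y => g y ^ (p : ℝ)) x ∂μ :=
        lintegral_mono fun x => lconvolution_rpow_le hp1 hf hg x
    _ = (∫⁻ y, f y ∂μ) ^ (p - 1 : ℝ) * ((∫⁻ y, f y ∂μ) * ∫⁻ x, g x ^ (p : ℝ) ∂μ) := by
        rw [lintegral_const_mul'' _ (aemeasurable_lconvolution hf (hg.pow_const _)),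
          lintegral_lconvolution hf (hg.pow_const _)]
    _ = (∫⁻ y, f y ∂μ) ^ (p : ℝ) * ∫⁻ x, g x ^ (p : ℝ) ∂μ := by
        nth_rw 2 [← ENNReal.rpow_one (∫⁻ y, f y ∂μ)]
        rw [← mul_assoc, ← ENNReal.rpow_add_of_nonneg _ _ (sub_nonneg.2 hp1) zero_le_one,
          sub_add_cancel]

theorem ae_convolutionExistsAt {p : ℝ≥0∞} (hp : 1 ≤ p) (hp_top : p ≠ ⊤) (hf : Integrable f μ)
    (hg : MemLp g p μ) : ∀ᵐ x ∂μ, ConvolutionExistsAt f g x L μ := by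
  have hYoung := eLpNorm_lconvolution_le hp hp_top hf.1.enorm hg.1.enorm
  rw [eLpNorm_enorm, eLpNorm_enorm] at hYoung
  have hfin : ∫⁻ x, ((‖f ·‖ₑ) ⋆ₗ[μ] (‖g ·‖ₑ)) x ^ p.toReal ∂μ < ⊤ :=
    lintegral_rpow_enorm_lt_top_of_eLpNorm_lt_top (one_pos.trans_le hp).ne' hp_top
      (hYoung.trans_lt (ENNReal.mul_lt_top (memLp_one_iff_integrable.2 hf).2 hg.2))
  filter_upwards [ae_lt_top' ((aemeasurable_lconvolution hf.1.enorm hg.1.enorm).pow_const _)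
    hfin.ne] with x hx
  refine ⟨hf.1.convolution_integrand_snd L hg.1 x,
    (lintegral_enorm_convolution_integrand_le L f g x).trans_lt (ENNReal.mul_lt_top (by simp) ?_)⟩
  exact (ENNReal.rpow_lt_top_iff_of_pos
    (ENNReal.toReal_pos (one_pos.trans_le hp).ne' hp_top)).1 hx

theorem eLpNorm_convolution_le [NormedSpace ℝ F₃] {p : ℝ≥0∞} (hp : 1 ≤ p) (hp_top : p ≠ ⊤)
    (hf : AEStronglyMeasurable f μ) (hg : AEStronglyMeasurable g μ) :
    eLpNorm (convolution f g L μ) p μ ≤ ‖L‖ₑ * (eLpNorm f 1 μ * eLpNorm g p μ) := by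
  rw [← eLpNorm_enorm f, ← eLpNorm_enorm g]
  refine (eLpNorm_le_mul_eLpNorm_of_ae_le_mul'' p
    (aemeasurable_lconvolution hf.enorm hg.enorm).aestronglyMeasurable
    (ae_of_all _ fun x => enorm_convolution_le L f g x)).trans ?_
  gcongr
  exact eLpNorm_lconvolution_le hp hp_top hf.enorm hg.enorm

theorem memLp_convolution [NormedSpace ℝ F₃] {p : ℝ≥0∞} (hp : 1 ≤ p) (hp_top : p ≠ ⊤)
    (hf : Integrable f μ) (hg : MemLp g p μ) : MemLp (convolution f g L μ) p μ :=
  ⟨(hf.1.convolution_integrand L hg.1).integral_prod_right',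
    (eLpNorm_convolution_le L hp hp_top hf.1 hg.1).trans_lt (ENNReal.mul_lt_top (by simp)
      (ENNReal.mul_lt_top (memLp_one_iff_integrable.2 hf).2 hg.2))⟩

end Young

section Fourier

open scoped Convolution

variable {E : Type*} [NormedAddCommGroup E] [InnerProductSpace ℝ E] [FiniteDimensional ℝ E]
  [MeasurableSpace E] [BorelSpace E] {F : Type*} [NormedAddCommGroup F] [InnerProductSpace ℂ F]

theorem integral_fourierInv_smul_eq [CompleteSpace F] {g : E → ℂ} {k : E → F} (hg : Integrable g)
    (hk : Integrable k) : ∫ x, 𝓕⁻ g x • k x = ∫ x, g x • 𝓕⁻ k x := by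
  have hflip : (-innerₗ E).flip = -innerₗ E := by
    ext x y
    simp [real_inner_comm]
  have h := VectorFourier.integral_fourierIntegral_smul_eq_flip (L := -innerₗ E) (μ := volume)
    (ν := volume) Real.continuous_fourierChar continuous_inner.neg hg hk
  rwa [hflip] at h

theorem continuous_fourierInv {k : E → F} (hk : Integrable k) : Continuous (𝓕⁻ k) := by
  rw [Real.fourierInv_eq_fourier_comp_neg]
  exact VectorFourier.fourierIntegral_continuous Real.continuous_fourierChar
    continuous_inner hk.comp_neg

theorem fourierInv_toLp_ae_eq [CompleteSpace F] {k : E → F} (h1 : Integrable k)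
    (h2 : MemLp k 2) :
    (𝓕⁻ (h2.toLp k) : Lp F 2 (volume : Measure E)) =ᵐ[volume] 𝓕⁻ k := by
  refine ae_eq_of_integral_contDiff_smul_eq ((Lp.memLp _).locallyIntegrable (by norm_num))
    (continuous_fourierInv h1).locallyIntegrable fun g hg hgc => ?_
  have hgc' : HasCompactSupport (Complex.ofRealCLM ∘ g) := hgc.comp_left rfl
  let φ : 𝓢(E, ℂ) := hgc'.toSchwartzMap (by fun_prop)
  have hφ (v : E → F) : ∫ x, φ x • v x = ∫ x, g x • v x :=
    integral_congr_ae (ae_of_all _ fun x => Complex.coe_smul (g x) (v x))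
  have htempered := congrArg (fun T : 𝓢'(E, F) => T φ)
    (Lp.fourierInv_toTemperedDistribution_eq (h2.toLp k))
  simp only [TemperedDistribution.fourierInv_apply, Lp.toTemperedDistribution_apply] at htempered
  calc ∫ x, g x • (𝓕⁻ (h2.toLp k) : Lp F 2 (volume : Measure E)) x
      = ∫ x, φ x • (𝓕⁻ (h2.toLp k) : Lp F 2 (volume : Measure E)) x := (hφ _).symm
    _ = ∫ x, 𝓕⁻ φ x • k x := by
        rw [← htempered]
        refine integral_congr_ae ?_
        filter_upwards [h2.coeFn_toLp] with x hx
        rw [hx]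
    _ = ∫ x, φ x • 𝓕⁻ k x := by
        rw [SchwartzMap.fourierInv_coe]
        exact integral_fourierInv_smul_eq φ.integrable h1
    _ = ∫ x, g x • 𝓕⁻ k x := hφ _

theorem eLpNorm_fourierInv [CompleteSpace F] {k : E → F} (h1 : Integrable k) (h2 : MemLp k 2) :
    eLpNorm (𝓕⁻ k) 2 volume = eLpNorm k 2 volume := by
  rw [← eLpNorm_congr_ae (fourierInv_toLp_ae_eq h1 h2), ← eLpNorm_congr_ae h2.coeFn_toLp,
    ← Lp.enorm_def, ← Lp.enorm_def, ← ofReal_norm, ← ofReal_norm, ← Lp.norm_fourier_eq,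
    FourierTransform.fourier_fourierInv_eq]

theorem fourierInv_convolution {a b : E → ℂ} (ha : Integrable a) (hb : Integrable b) (x : E) :
    𝓕⁻ (a ⋆[ContinuousLinearMap.mul ℂ ℂ] b) x = 𝓕⁻ a x * 𝓕⁻ b x := by
  simp only [Real.fourierInv_eq_fourier_neg]
  exact Real.fourier_mul_convolution_eq ha hb (-x)

theorem fourierInv_add {k l : E → F} (hk : Integrable k) (hl : Integrable l) :
    𝓕⁻ (k + l) = 𝓕⁻ k + 𝓕⁻ l :=
  VectorFourier.fourierIntegral_add (L := -innerₗ E) Real.continuous_fourierChar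
    continuous_inner.neg hk hl

theorem fourierInv_const_smul (c : ℂ) (k : E → F) : 𝓕⁻ (c • k) = c • 𝓕⁻ k :=
  VectorFourier.fourierIntegral_const_smul _ _ _ _ _

theorem fourierInv_conj_comp_neg (a : E → ℂ) (x : E) :
    𝓕⁻ (fun ξ => starRingEnd ℂ (a (-ξ))) x = starRingEnd ℂ (𝓕⁻ a x) := by
  rw [Real.fourierInv_eq, Real.fourierInv_eq, ← integral_conj, ← integral_neg_eq_self]
  refine integral_congr_ae (ae_of_all _ fun ξ => ?_)
  simp only [Circle.smul_def, smul_eq_mul, neg_neg, map_mul, inner_neg_left,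
    AddChar.map_neg_eq_inv, Circle.coe_inv_eq_conj]

variable {a : E → ℂ}

theorem memLp_convolution_mul (ha : Integrable a) {h : E → ℂ} (hh : MemLp h 2) :
    MemLp (a ⋆[ContinuousLinearMap.mul ℂ ℂ] h) 2 volume :=
  memLp_convolution _ one_le_two ENNReal.ofNat_ne_top ha hh

theorem eLpNorm_convolution_mul_le (ha : Integrable a) {h : E → ℂ} (hh : MemLp h 2) :
    eLpNorm (a ⋆[ContinuousLinearMap.mul ℂ ℂ] h) 2 volume ≤
      eLpNorm a 1 volume * eLpNorm h 2 volume := by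
  refine (eLpNorm_convolution_le (ContinuousLinearMap.mul ℂ ℂ) one_le_two ENNReal.ofNat_ne_top
    ha.aestronglyMeasurable hh.aestronglyMeasurable).trans (mul_le_of_le_one_left' ?_)
  simp [enorm]

theorem ae_convolutionExistsAt_mul (ha : Integrable a) {h : E → ℂ} (hh : MemLp h 2) :
    ∀ᵐ ξ, ConvolutionExistsAt a h ξ (ContinuousLinearMap.mul ℂ ℂ) :=
  ae_convolutionExistsAt _ one_le_two ENNReal.ofNat_ne_top ha hh

/-- Convolution with an integrable function, as a bounded operator on `L²`. -/
def convL (ha : Integrable a) : Lp ℂ 2 (volume : Measure E) →L[ℂ] Lp ℂ 2 (volume : Measure E) :=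
  LinearMap.mkContinuous
    { toFun h := (memLp_convolution_mul ha (Lp.memLp h)).toLp
      map_add' g h := by
        rw [← MemLp.toLp_add]
        refine MemLp.toLp_congr _ _ ?_
        rw [convolution_congr _ Filter.EventuallyEq.rfl (Lp.coeFn_add g h)]
        filter_upwards [ae_convolutionExistsAt_mul ha (Lp.memLp g),
          ae_convolutionExistsAt_mul ha (Lp.memLp h)] with ξ hg hh using hg.distrib_add hh
      map_smul' c h := by
        rw [RingHom.id_apply, ← MemLp.toLp_const_smul]
        refine MemLp.toLp_congr _ _ ?_
        rw [convolution_congr _ Filter.EventuallyEq.rfl (Lp.coeFn_smul c h), convolution_smul] }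
    (eLpNorm a 1 volume).toReal fun h => by
      change ‖(memLp_convolution_mul ha (Lp.memLp h)).toLp‖ ≤ _
      rw [Lp.norm_toLp, Lp.norm_def, ← ENNReal.toReal_mul]
      exact ENNReal.toReal_mono (ENNReal.mul_ne_top (memLp_one_iff_integrable.2 ha).eLpNorm_ne_top
        (Lp.eLpNorm_ne_top h)) (eLpNorm_convolution_mul_le ha (Lp.memLp h))

theorem convL_ae_eq (ha : Integrable a) (h : Lp ℂ 2 (volume : Measure E)) :
    convL ha h =ᵐ[volume] a ⋆[ContinuousLinearMap.mul ℂ ℂ] h :=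
  (memLp_convolution_mul ha (Lp.memLp h)).coeFn_toLp

/-- Plancherel turns convolution by `a` into multiplication by the bounded function `𝓕⁻ a`. -/
theorem eLpNorm_smul_add_convolution_le_of_integrable (ha : Integrable a) {c : ℂ} {M : ℝ}
    (hM : ∀ x, ‖c + 𝓕⁻ a x‖ ≤ M) {h : E → ℂ} (h1 : Integrable h) (h2 : MemLp h 2) :
    eLpNorm (c • h + a ⋆[ContinuousLinearMap.mul ℂ ℂ] h) 2 volume ≤
      ENNReal.ofReal M * eLpNorm h 2 volume := by
  have hconv : Integrable (a ⋆[ContinuousLinearMap.mul ℂ ℂ] h) :=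
    ha.integrable_convolution _ h1
  rw [← eLpNorm_fourierInv ((h1.smul c).add hconv)
      ((h2.const_smul c).add (memLp_convolution_mul ha h2)), ← eLpNorm_fourierInv h1 h2]
  refine eLpNorm_le_mul_eLpNorm_of_ae_le_mul (ae_of_all _ fun x => ?_) 2
  rw [fourierInv_add (h1.smul c) hconv, fourierInv_const_smul, Pi.add_apply, Pi.smul_apply,
    fourierInv_convolution ha h1, smul_eq_mul, ← add_mul, norm_mul]
  gcongr
  exact hM x

theorem enorm_smul_add_convL (ha : Integrable a) (c : ℂ) {h : E → ℂ}
    (hh : MemLp h 2 (volume : Measure E)) : ‖c • hh.toLp h + convL ha (hh.toLp h)‖ₑ =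
      eLpNorm (c • h + a ⋆[ContinuousLinearMap.mul ℂ ℂ] h) 2 volume := by
  rw [Lp.enorm_def]
  refine eLpNorm_congr_ae ?_
  filter_upwards [Lp.coeFn_add (c • hh.toLp h) (convL ha (hh.toLp h)),
    Lp.coeFn_smul c (hh.toLp h), hh.coeFn_toLp, convL_ae_eq ha (hh.toLp h)] with ξ h1 h2 h3 h4
  rw [h1, Pi.add_apply, Pi.add_apply, h2, h4, Pi.smul_apply, Pi.smul_apply, h3,
    convolution_congr _ Filter.EventuallyEq.rfl hh.coeFn_toLp]

theorem enorm_smul_add_convL_le (ha : Integrable a) {c : ℂ} {M : ℝ}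
    (hM : ∀ x, ‖c + 𝓕⁻ a x‖ ≤ M) (h : Lp ℂ 2 (volume : Measure E)) :
    ‖c • h + convL ha h‖ₑ ≤ ENNReal.ofReal M * ‖h‖ₑ := by
  refine (SchwartzMap.denseRange_toLpCLM (F := ℂ) (p := 2) (μ := (volume : Measure E))
    ENNReal.ofNat_ne_top).induction_on
    (p := fun h => ‖c • h + convL ha h‖ₑ ≤ ENNReal.ofReal M * ‖h‖ₑ) h
    (isClosed_le (by fun_prop) (by fun_prop (disch := simp))) fun g => ?_
  have hg := g.memLp 2 (volume : Measure E)
  change ‖c • hg.toLp g + convL ha (hg.toLp g)‖ₑ ≤ ENNReal.ofReal M * ‖hg.toLp g‖ₑ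
  rw [enorm_smul_add_convL, Lp.enorm_toLp]
  exact eLpNorm_smul_add_convolution_le_of_integrable ha hM g.integrable hg

theorem eLpNorm_smul_add_convolution_le (ha : Integrable a) {c : ℂ} {M : ℝ}
    (hM : ∀ x, ‖c + 𝓕⁻ a x‖ ≤ M) {h : E → ℂ} (hh : MemLp h 2) :
    eLpNorm (c • h + a ⋆[ContinuousLinearMap.mul ℂ ℂ] h) 2 volume ≤
      ENNReal.ofReal M * eLpNorm h 2 volume := by
  rw [← enorm_smul_add_convL ha c hh, ← Lp.enorm_toLp hh]
  exact enorm_smul_add_convL_le ha hM _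

end Fourier

section Weighted

open scoped Convolution

variable {E F : Type*} [NormedAddCommGroup E] [NormedAddCommGroup F] [NormedSpace ℝ F]

/-- The function `ξ ↦ (1 + |ξ|²)^{s/2} a(ξ)`. -/
def weighted (s : ℝ) (a : E → F) : E → F := fun ξ => weight s ξ • a ξ

theorem weighted_weighted (r s : ℝ) (a : E → F) :
    weighted r (weighted s a) = weighted (r + s) a := by
  ext ξ
  simp only [weighted, smul_smul, weight_mul]

@[simp] theorem weighted_zero_left (a : E → F) : weighted 0 a = a := by
  ext ξ
  simp only [weighted, weight_zero, one_smul]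

theorem weighted_add (s : ℝ) (a b : E → F) : weighted s (a + b) = weighted s a + weighted s b :=
  funext fun ξ => smul_add (weight s ξ) (a ξ) (b ξ)

theorem weighted_const_smul (s : ℝ) (c : ℂ) (a : E → ℂ) : weighted s (c • a) = c • weighted s a :=
  funext fun ξ => smul_comm (weight s ξ) c (a ξ)

theorem norm_weighted (s : ℝ) (a : E → F) (ξ : E) : ‖weighted s a ξ‖ = weight s ξ * ‖a ξ‖ := by
  rw [weighted, norm_smul, Real.norm_of_nonneg (weight_pos s ξ).le]

theorem weighted_conj_comp_neg (s : ℝ) (a : E → ℂ) :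
    weighted s (fun ξ => starRingEnd ℂ (a (-ξ))) = fun ξ => starRingEnd ℂ (weighted s a (-ξ)) := by
  ext ξ
  simp [weighted, weight_neg]

variable [MeasurableSpace E] {μ : Measure E} {p : ℝ≥0∞}

theorem weighted_congr_ae (s : ℝ) {a b : E → F} (h : a =ᵐ[μ] b) :
    weighted s a =ᵐ[μ] weighted s b := by
  filter_upwards [h] with ξ hξ
  simp only [weighted, hξ]

theorem eLpNorm_weighted_mono {r s : ℝ} (h : r ≤ s) (a : E → F) :
    eLpNorm (weighted r a) p μ ≤ eLpNorm (weighted s a) p μ := by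
  refine eLpNorm_mono fun ξ => ?_
  rw [norm_weighted, norm_weighted]
  gcongr
  exact weight_mono h ξ

variable [BorelSpace E] [SecondCountableTopologyEither E ℝ]

theorem aestronglyMeasurable_weighted (s : ℝ) {a : E → F} (ha : AEStronglyMeasurable a μ) :
    AEStronglyMeasurable (weighted s a) μ :=
  (continuous_weight s).aestronglyMeasurable.smul ha

theorem aestronglyMeasurable_of_weighted {s : ℝ} {a : E → F} (ha : MemLp (weighted s a) p μ) :
    AEStronglyMeasurable a μ := by
  have h := aestronglyMeasurable_weighted (-s) ha.1
  rwa [weighted_weighted, neg_add_cancel, weighted_zero_left] at h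

theorem memLp_weighted_of_le {r s : ℝ} (h : r ≤ s) {a : E → F} (ha : MemLp (weighted s a) p μ) :
    MemLp (weighted r a) p μ :=
  ⟨aestronglyMeasurable_weighted r (aestronglyMeasurable_of_weighted ha),
    (eLpNorm_weighted_mono h a).trans_lt ha.2⟩

theorem memLp_of_weighted {s : ℝ} (hs : 0 ≤ s) {a : E → F} (ha : MemLp (weighted s a) p μ) :
    MemLp a p μ := by
  simpa only [weighted_zero_left] using memLp_weighted_of_le hs ha

theorem eLpNorm_one_weighted_le (r s : ℝ) {a : E → F} (ha : AEStronglyMeasurable a μ) :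
    eLpNorm (weighted r a) 1 μ ≤
      eLpNorm (weight (r - s)) 2 μ * eLpNorm (weighted s a) 2 μ := by
  rw [← sub_add_cancel r s, ← weighted_weighted, add_sub_cancel_right]
  exact eLpNorm_smul_le_mul_eLpNorm (aestronglyMeasurable_weighted s ha)
    (continuous_weight (r - s)).aestronglyMeasurable

theorem exists_eLpNorm_weighted_le (E : Type*) [NormedAddCommGroup E] [MeasurableSpace E]
    [BorelSpace E] [SecondCountableTopologyEither E ℝ] {ρ s : ℝ} (h : ρ < s) :
    ∃ m : ℕ, ∀ (μ : Measure E) (p : ℝ≥0∞) (a : E → F) (ε : ℝ), AEStronglyMeasurable a μ → 1 ≤ p →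
      0 < ε → eLpNorm (weighted ρ a) p μ ≤
        ENNReal.ofReal ε * eLpNorm (weighted s a) p μ
          + ENNReal.ofReal (ε⁻¹ ^ m) * eLpNorm a p μ := by
  obtain ⟨m, hm⟩ := exists_weight_le_mul_add_pow E h
  refine ⟨m, fun μ p a ε ha hp hε => ?_⟩
  have hscale {c : ℝ} (hc : 0 ≤ c) (b : E → F) :
      eLpNorm (fun ξ => c * ‖b ξ‖) p μ = ENNReal.ofReal c * eLpNorm b p μ := by
    rw [← eLpNorm_norm b, ← Real.enorm_of_nonneg hc]
    exact eLpNorm_const_smul c (fun ξ => ‖b ξ‖) p μ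
  rw [← hscale hε.le, ← hscale (by positivity)]
  refine (eLpNorm_mono_real fun ξ => ?_).trans (eLpNorm_add_le
    ((aestronglyMeasurable_weighted s ha).norm.const_mul ε) (ha.norm.const_mul _) hp)
  rw [Pi.add_apply, norm_weighted, norm_weighted, ← mul_assoc, ← add_mul]
  gcongr
  exact hm ξ ε hε

end Weighted

section Commutator

open scoped Convolution

variable {E : Type*} [NormedAddCommGroup E] {a b : E → ℂ} {s ρ : ℝ}

theorem norm_weight_smul_mul_sub_le {C : ℝ≥0}
    (hC : ∀ ξ η : E, |weight s ξ - weight s η| ≤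
      C * (weight s (ξ - η) + weight (s - ρ) (ξ - η) * weight ρ η)) (ξ η : E) :
    ‖weight s ξ • (a η * b (ξ - η)) - a η * weighted s b (ξ - η)‖ ≤
      C * (‖weighted s a η‖ * ‖b (ξ - η)‖ + ‖weighted (s - ρ) a η‖ * ‖weighted ρ b (ξ - η)‖) := by
  have hfactor : weight s ξ • (a η * b (ξ - η)) - a η * weighted s b (ξ - η)
      = (weight s ξ - weight s (ξ - η)) • (a η * b (ξ - η)) := by
    rw [weighted, mul_smul_comm, sub_smul]
  have hC' := hC ξ (ξ - η)
  rw [sub_sub_cancel] at hC'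
  rw [hfactor, norm_smul, norm_mul, Real.norm_eq_abs]
  calc |weight s ξ - weight s (ξ - η)| * (‖a η‖ * ‖b (ξ - η)‖)
      ≤ C * (weight s η + weight (s - ρ) η * weight ρ (ξ - η)) * (‖a η‖ * ‖b (ξ - η)‖) := by gcongr
    _ = _ := by
        simp only [norm_weighted]
        ring

variable [MeasurableSpace E] [BorelSpace E] [SecondCountableTopologyEither E ℝ]

theorem enorm_weighted_convolution_sub_le {μ : Measure E} {C : ℝ≥0}
    (hC : ∀ ξ η : E, |weight s ξ - weight s η| ≤
      C * (weight s (ξ - η) + weight (s - ρ) (ξ - η) * weight ρ η)) {ξ : E}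
    (h : ConvolutionExistsAt a b ξ (ContinuousLinearMap.mul ℂ ℂ) μ)
    (hs : ConvolutionExistsAt a (weighted s b) ξ (ContinuousLinearMap.mul ℂ ℂ) μ) :
    ‖(weighted s (a ⋆[ContinuousLinearMap.mul ℂ ℂ, μ] b)
        - a ⋆[ContinuousLinearMap.mul ℂ ℂ, μ] weighted s b) ξ‖ₑ ≤
      C * (((‖weighted s a ·‖ₑ) ⋆ₗ[μ] (‖b ·‖ₑ)) ξ
        + ((‖weighted (s - ρ) a ·‖ₑ) ⋆ₗ[μ] (‖weighted ρ b ·‖ₑ)) ξ) := by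
  have hmeas : AEMeasurable (fun η => ‖weighted s a η‖ₑ * ‖b (ξ - η)‖ₑ) μ := by
    refine (AEStronglyMeasurable.smul (continuous_weight s).aestronglyMeasurable h.1).enorm.congr
      (ae_of_all _ fun η => ?_)
    simp [weighted, mul_assoc]
  calc ‖(weighted s (a ⋆[ContinuousLinearMap.mul ℂ ℂ, μ] b)
        - a ⋆[ContinuousLinearMap.mul ℂ ℂ, μ] weighted s b) ξ‖ₑ
      = ‖∫ η, weight s ξ • (a η * b (ξ - η)) - a η * weighted s b (ξ - η) ∂μ‖ₑ := by
        rw [Pi.sub_apply, weighted, convolution_def, convolution_def, ← integral_smul]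
        exact congrArg _ (integral_sub (Integrable.smul (weight s ξ) h) hs).symm
    _ ≤ ∫⁻ η, ‖weight s ξ • (a η * b (ξ - η)) - a η * weighted s b (ξ - η)‖ₑ ∂μ :=
        enorm_integral_le_lintegral_enorm _
    _ ≤ ∫⁻ η, C * (‖weighted s a η‖ₑ * ‖b (ξ - η)‖ₑ
          + ‖weighted (s - ρ) a η‖ₑ * ‖weighted ρ b (ξ - η)‖ₑ) ∂μ := by
        refine lintegral_mono fun η => ?_
        simp only [enorm, ← ENNReal.coe_mul, ← ENNReal.coe_add, ENNReal.coe_le_coe]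
        exact norm_weight_smul_mul_sub_le hC ξ η
    _ = _ := by
        rw [lintegral_const_mul' _ _ ENNReal.coe_ne_top, lintegral_add_left' hmeas]
        simp only [lconvolution_def, neg_add_eq_sub]

end Commutator

section CommutatorNorm

open scoped Convolution

variable {E : Type*} [NormedAddCommGroup E] [InnerProductSpace ℝ E] [FiniteDimensional ℝ E]
  [MeasurableSpace E] [BorelSpace E] {a b : E → ℂ} {s ρ : ℝ}

theorem integrable_of_memLp_weighted (hs : (Module.finrank ℝ E : ℝ) / 2 < s)
    (ha : MemLp (weighted s a) 2) : Integrable a := by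
  have ham := aestronglyMeasurable_of_weighted ha
  have h := eLpNorm_one_weighted_le 0 s ham (μ := volume)
  rw [weighted_zero_left, zero_sub] at h
  exact memLp_one_iff_integrable.1
    ⟨ham, h.trans_lt (ENNReal.mul_lt_top (memLp_weight_neg hs).2 ha.2)⟩

theorem eLpNorm_weighted_convolution_sub_le {C : ℝ≥0}
    (hC : ∀ ξ η : E, |weight s ξ - weight s η| ≤
      C * (weight s (ξ - η) + weight (s - ρ) (ξ - η) * weight ρ η)) (ha : Integrable a)
    (has : MemLp (weighted s a) 2) (hb : MemLp b 2) (hbs : MemLp (weighted s b) 2) :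
    eLpNorm (weighted s (a ⋆[ContinuousLinearMap.mul ℂ ℂ] b)
        - a ⋆[ContinuousLinearMap.mul ℂ ℂ] weighted s b) 2 volume ≤
      C * (eLpNorm b 1 volume * eLpNorm (weighted s a) 2 volume
        + eLpNorm (weighted (s - ρ) a) 1 volume * eLpNorm (weighted ρ b) 2 volume) := by
  have ham := (aestronglyMeasurable_weighted (s - ρ) ha.1).enorm
  have hbm := (aestronglyMeasurable_weighted ρ hb.1).enorm
  have hmeas := (aemeasurable_lconvolution has.1.enorm hb.1.enorm).aestronglyMeasurable
  refine (eLpNorm_le_mul_eLpNorm_of_ae_le_mul'' (c := C) 2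
    (hmeas.add (aemeasurable_lconvolution ham hbm).aestronglyMeasurable) ?_).trans ?_
  · filter_upwards [ae_convolutionExistsAt_mul ha hb, ae_convolutionExistsAt_mul ha hbs]
      with ξ h hs using enorm_weighted_convolution_sub_le hC h hs
  gcongr
  refine (eLpNorm_add_le hmeas (aemeasurable_lconvolution ham hbm).aestronglyMeasurable
    one_le_two).trans (add_le_add ?_ ?_)
  · rw [lconvolution_comm]
    simpa only [eLpNorm_enorm] using
      eLpNorm_lconvolution_le one_le_two ENNReal.ofNat_ne_top hb.1.enorm has.1.enorm
  · simpa only [eLpNorm_enorm] using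
      eLpNorm_lconvolution_le one_le_two ENNReal.ofNat_ne_top ham hbm

/-- Commuting the weight past a convolution gains up to one order on the second factor. -/
theorem exists_eLpNorm_weighted_convolution_sub_le (E : Type*) [NormedAddCommGroup E]
    [InnerProductSpace ℝ E] [FiniteDimensional ℝ E] [MeasurableSpace E] [BorelSpace E]
    (hρ : (Module.finrank ℝ E : ℝ) / 2 < ρ) (hsρ : s - 1 ≤ ρ) (hρs : ρ ≤ s) :
    ∃ K : ℝ≥0, ∀ a b : E → ℂ, MemLp (weighted s a) 2 → MemLp (weighted s b) 2 →
      eLpNorm (weighted s (a ⋆[ContinuousLinearMap.mul ℂ ℂ] b)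
        - a ⋆[ContinuousLinearMap.mul ℂ ℂ] weighted s b) 2 volume ≤
      K * (eLpNorm (weighted s a) 2 volume * eLpNorm (weighted ρ b) 2 volume) := by
  have hs : 0 < s := (div_nonneg (Nat.cast_nonneg _) zero_le_two).trans_lt (hρ.trans_le hρs)
  obtain ⟨C, hC⟩ := exists_abs_weight_sub_le (E := E) hs hsρ
  let W := eLpNorm (weight (-ρ) : E → ℝ) 2 volume
  have hW : W ≠ ⊤ := (memLp_weight_neg hρ).eLpNorm_ne_top
  refine ⟨C * (2 * W.toNNReal), fun a b ha hb => ?_⟩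
  have hb1 : eLpNorm b 1 volume ≤ W * eLpNorm (weighted ρ b) 2 volume := by
    simpa only [weighted_zero_left, zero_sub] using
      eLpNorm_one_weighted_le 0 ρ (aestronglyMeasurable_of_weighted hb)
  have ha1 : eLpNorm (weighted (s - ρ) a) 1 volume ≤ W * eLpNorm (weighted s a) 2 volume := by
    simpa only [sub_sub_cancel_left] using
      eLpNorm_one_weighted_le (s - ρ) s (aestronglyMeasurable_of_weighted ha)
  calc _ ≤ C * (eLpNorm b 1 volume * eLpNorm (weighted s a) 2 volume
        + eLpNorm (weighted (s - ρ) a) 1 volume * eLpNorm (weighted ρ b) 2 volume) :=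
        eLpNorm_weighted_convolution_sub_le hC (integrable_of_memLp_weighted (hρ.trans_le hρs) ha)
          ha (memLp_of_weighted hs.le hb) hb
    _ ≤ C * (W * eLpNorm (weighted ρ b) 2 volume * eLpNorm (weighted s a) 2 volume
        + W * eLpNorm (weighted s a) 2 volume * eLpNorm (weighted ρ b) 2 volume) := by gcongr
    _ = _ := by
        push_cast
        rw [ENNReal.coe_toNNReal hW]
        ring

theorem memLp_weighted_convolution (hs : (Module.finrank ℝ E : ℝ) / 2 < s)
    (ha : MemLp (weighted s a) 2) (hb : MemLp (weighted s b) 2) :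
    MemLp (weighted s (a ⋆[ContinuousLinearMap.mul ℂ ℂ] b)) 2 := by
  obtain ⟨K, hK⟩ := exists_eLpNorm_weighted_convolution_sub_le E hs (sub_one_lt s).le le_rfl
  have hs0 : 0 ≤ s := (div_nonneg (Nat.cast_nonneg _) zero_le_two).trans hs.le
  have hai := integrable_of_memLp_weighted hs ha
  have hconv := memLp_convolution_mul hai hb
  have hcomm : MemLp (weighted s (a ⋆[ContinuousLinearMap.mul ℂ ℂ] b)
      - a ⋆[ContinuousLinearMap.mul ℂ ℂ] weighted s b) 2 :=
    ⟨(aestronglyMeasurable_weighted s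
      (memLp_convolution_mul hai (memLp_of_weighted hs0 hb)).1).sub hconv.1,
      (hK a b ha hb).trans_lt (by finiteness [ha.2.ne, hb.2.ne])⟩
  simpa only [sub_add_cancel] using hcomm.add hconv

theorem exists_eLpNorm_weighted_smul_add_convolution_le (E : Type*) [NormedAddCommGroup E]
    [InnerProductSpace ℝ E] [FiniteDimensional ℝ E] [MeasurableSpace E] [BorelSpace E]
    (hs : (Module.finrank ℝ E : ℝ) / 2 < s) :
    ∃ (K : ℝ≥0) (m : ℕ), ∀ (a b : E → ℂ) (c : ℂ) (M ε : ℝ), MemLp (weighted s a) 2 →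
      MemLp (weighted s b) 2 → (∀ x, ‖c + 𝓕⁻ a x‖ ≤ M) → 0 < ε →
      eLpNorm (weighted s (c • b + a ⋆[ContinuousLinearMap.mul ℂ ℂ] b)) 2 volume ≤
        ENNReal.ofReal M * eLpNorm (weighted s b) 2 volume
          + K * (eLpNorm (weighted s a) 2 volume * (ENNReal.ofReal ε *
            eLpNorm (weighted s b) 2 volume + ENNReal.ofReal (ε⁻¹ ^ m) * eLpNorm b 2 volume)) := by
  obtain ⟨ρ, hρ, hρs⟩ := exists_between (max_lt hs (sub_one_lt s))
  obtain ⟨hdρ, hsρ⟩ := max_lt_iff.1 hρ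
  obtain ⟨K, hK⟩ := exists_eLpNorm_weighted_convolution_sub_le E hdρ hsρ.le hρs.le
  obtain ⟨m, hm⟩ := exists_eLpNorm_weighted_le (F := ℂ) E hρs
  refine ⟨K, m, fun a b c M ε ha hb hM hε => ?_⟩
  have hai := integrable_of_memLp_weighted hs ha
  have hbm := aestronglyMeasurable_of_weighted hb
  have hconv := memLp_convolution_mul hai hb
  have hsplit : weighted s (c • b + a ⋆[ContinuousLinearMap.mul ℂ ℂ] b)
      = (c • weighted s b + a ⋆[ContinuousLinearMap.mul ℂ ℂ] weighted s b)
        + (weighted s (a ⋆[ContinuousLinearMap.mul ℂ ℂ] b)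
          - a ⋆[ContinuousLinearMap.mul ℂ ℂ] weighted s b) := by
    rw [weighted_add, weighted_const_smul]
    abel
  rw [hsplit]
  refine (eLpNorm_add_le ((hb.const_smul c).add hconv).1
    ((memLp_weighted_convolution hs ha hb).sub hconv).1 one_le_two).trans (add_le_add ?_ ?_)
  · exact eLpNorm_smul_add_convolution_le hai hM hb
  · refine (hK a b ha hb).trans ?_
    gcongr
    exact hm volume 2 b ε hbm one_le_two hε

end CommutatorNorm

namespace Hs

section Basic

variable {d : ℕ} {s : ℝ}

/-- The Fourier transform of `u`, as a function. -/
def hat (u : Hs d s) : Rd d → ℂ := ⇑(𝓕 u.toL2 : L2 d)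

theorem memLp_hat (u : Hs d s) : MemLp u.hat 2 := Lp.memLp _

theorem weightedFourierFun_toL2 (u : Hs d s) : weightedFourierFun d s u.toL2 = weighted s u.hat :=
  funext fun _ => (Complex.real_smul).symm

theorem memLp_weighted_hat (u : Hs d s) : MemLp (weighted s u.hat) 2 :=
  u.weightedFourierFun_toL2 ▸ u.2

theorem norm_eq_eLpNorm_weighted_hat (u : Hs d s) :
    ‖u‖ = (eLpNorm (weighted s u.hat) 2 volume).toReal := by
  rw [Hs.norm_eq, weightedFourierFun_toL2]

theorem norm_toL2 (u : Hs d s) : ‖u.toL2‖ = (eLpNorm u.hat 2 volume).toReal := by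
  rw [← Lp.norm_fourier_eq, Lp.norm_def, hat]

theorem enorm_eq_eLpNorm_weighted_hat (u : Hs d s) :
    ‖u‖ₑ = eLpNorm (weighted s u.hat) 2 volume := by
  rw [← ofReal_norm, norm_eq_eLpNorm_weighted_hat,
    ENNReal.ofReal_toReal u.memLp_weighted_hat.eLpNorm_ne_top]

theorem enorm_toL2 (u : Hs d s) : ‖u.toL2‖ₑ = eLpNorm u.hat 2 volume := by
  rw [← ofReal_norm, norm_toL2, ENNReal.ofReal_toReal u.memLp_hat.eLpNorm_ne_top]

theorem hat_add (u v : Hs d s) : (u + v).hat =ᵐ[volume] u.hat + v.hat := by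
  rw [hat, map_add, FourierTransform.fourier_add]
  exact Lp.coeFn_add _ _

theorem hat_smul (c : ℂ) (u : Hs d s) : (c • u).hat =ᵐ[volume] c • u.hat := by
  rw [hat, map_smul, FourierTransform.fourier_smul]
  exact Lp.coeFn_smul _ _

theorem toL2_injective : Function.Injective (toL2 : Hs d s →ₗ[ℂ] L2 d) := Subtype.val_injective

theorem norm_toL2_le (hs : 0 ≤ s) (u : Hs d s) : ‖u.toL2‖ ≤ ‖u‖ := by
  rw [norm_toL2, norm_eq_eLpNorm_weighted_hat]
  refine ENNReal.toReal_mono u.memLp_weighted_hat.eLpNorm_ne_top ?_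
  simpa only [weighted_zero_left] using eLpNorm_weighted_mono hs u.hat

/-- The element of `H^s` with Fourier transform `a`. -/
def ofHat (hs : 0 ≤ s) {a : Rd d → ℂ} (ha : MemLp (weighted s a) 2) : Hs d s :=
  ⟨𝓕⁻ ((memLp_of_weighted hs ha).toLp a), by
    refine ha.ae_eq ?_
    filter_upwards [(memLp_of_weighted hs ha).coeFn_toLp] with ξ hξ
    rw [weightedFourierFun, FourierTransform.fourier_fourierInv_eq, hξ, ← Complex.real_smul]
    rfl⟩

theorem hat_ofHat (hs : 0 ≤ s) {a : Rd d → ℂ} (ha : MemLp (weighted s a) 2) :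
    (ofHat hs ha).hat =ᵐ[volume] a := by
  change ((𝓕 (𝓕⁻ ((memLp_of_weighted hs ha).toLp a) : L2 d) : L2 d) : Rd d → ℂ) =ᵐ[volume] a
  rw [FourierTransform.fourier_fourierInv_eq]
  exact (memLp_of_weighted hs ha).coeFn_toLp

theorem norm_ofHat (hs : 0 ≤ s) {a : Rd d → ℂ} (ha : MemLp (weighted s a) 2) :
    ‖ofHat hs ha‖ = (eLpNorm (weighted s a) 2 volume).toReal := by
  rw [norm_eq_eLpNorm_weighted_hat, eLpNorm_congr_ae (weighted_congr_ae s (hat_ofHat hs ha))]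

theorem completeSpace (hs : 0 ≤ s) : CompleteSpace (Hs d s) := by
  have hiso : Isometry (Hs.weightedFourier d s) :=
    AddMonoidHomClass.isometry_of_norm _ fun _ => rfl
  refine (hiso.isUniformInducing.completeSpace_congr fun g => ?_).2 inferInstance
  have hg : weighted s (weighted (-s) g) = g := by
    rw [weighted_weighted, add_neg_cancel, weighted_zero_left]
  have hmem : MemLp (weighted s (weighted (-s) g)) 2 := hg.symm ▸ Lp.memLp g
  refine ⟨ofHat hs hmem, Lp.ext ((MemLp.coeFn_toLp (ofHat hs hmem).2).trans ?_)⟩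
  exact (ofHat hs hmem).weightedFourierFun_toL2 ▸
    (weighted_congr_ae s (hat_ofHat hs hmem)).trans hg.eventuallyEq

end Basic

section Evaluation

variable {d : ℕ} {s : ℝ}

theorem finrank_Rd_div_two_lt [hs : Fact ((d : ℝ) / 2 < s)] :
    (Module.finrank ℝ (Rd d) : ℝ) / 2 < s := by
  rw [finrank_euclideanSpace_fin]
  exact hs.out

variable (d s) in
theorem order_nonneg [hs : Fact ((d : ℝ) / 2 < s)] : 0 ≤ s :=
  (div_nonneg (Nat.cast_nonneg d) zero_le_two).trans hs.out.le

instance [Fact ((d : ℝ) / 2 < s)] : CompleteSpace (Hs d s) := completeSpace (order_nonneg d s)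

variable (d s) in
/-- A bound for the norm of the embedding of `H^s` into the bounded functions. -/
def embeddingConst : ℝ := (eLpNorm (weight (-s) : Rd d → ℝ) 2 volume).toReal

variable (d s) in
theorem embeddingConst_nonneg : 0 ≤ embeddingConst d s := ENNReal.toReal_nonneg

variable [Fact ((d : ℝ) / 2 < s)]

theorem integrable_hat (u : Hs d s) : Integrable u.hat :=
  integrable_of_memLp_weighted finrank_Rd_div_two_lt u.memLp_weighted_hat

theorem norm_fourierInv_hat_le (u : Hs d s) (x : Rd d) :
    ‖𝓕⁻ u.hat x‖ ≤ embeddingConst d s * ‖u‖ := by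
  have h1 : eLpNorm u.hat 1 volume ≤
      eLpNorm (weight (-s) : Rd d → ℝ) 2 volume * eLpNorm (weighted s u.hat) 2 volume := by
    simpa only [weighted_zero_left, zero_sub] using
      eLpNorm_one_weighted_le 0 s u.memLp_hat.1
  calc ‖𝓕⁻ u.hat x‖ ≤ ∫ ξ, ‖u.hat ξ‖ :=
        VectorFourier.norm_fourierIntegral_le_integral_norm _ _ _ _ _
    _ = (eLpNorm u.hat 1 volume).toReal := by
        rw [integral_norm_eq_lintegral_enorm u.memLp_hat.1, eLpNorm_one_eq_lintegral_enorm]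
    _ ≤ embeddingConst d s * ‖u‖ := by
        rw [embeddingConst, norm_eq_eLpNorm_weighted_hat, ← ENNReal.toReal_mul]
        exact ENNReal.toReal_mono (ENNReal.mul_ne_top
          (memLp_weight_neg finrank_Rd_div_two_lt).eLpNorm_ne_top
          u.memLp_weighted_hat.eLpNorm_ne_top) h1

/-- Evaluation at `x` of the continuous representative `𝓕⁻ û` of `u`. -/
def ev (x : Rd d) : Hs d s →L[ℂ] ℂ :=
  LinearMap.mkContinuous
    { toFun u := 𝓕⁻ u.hat x
      map_add' u v := by
        rw [Real.fourierInv_congr_ae (hat_add u v),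
          fourierInv_add u.integrable_hat v.integrable_hat, Pi.add_apply]
      map_smul' c u := by
        rw [Real.fourierInv_congr_ae (hat_smul c u), fourierInv_const_smul, Pi.smul_apply,
          RingHom.id_apply] }
    (embeddingConst d s) fun u => norm_fourierInv_hat_le u x

theorem ev_apply (x : Rd d) (u : Hs d s) : ev x u = 𝓕⁻ u.hat x := rfl

theorem norm_ev_le (x : Rd d) (u : Hs d s) : ‖ev x u‖ ≤ embeddingConst d s * ‖u‖ :=
  norm_fourierInv_hat_le u x

theorem ev_ofHat (x : Rd d) (hs : 0 ≤ s) {a : Rd d → ℂ} (ha : MemLp (weighted s a) 2) :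
    ev x (ofHat hs ha) = 𝓕⁻ a x := by
  rw [ev_apply, Real.fourierInv_congr_ae (hat_ofHat hs ha)]

theorem toL2_ae_eq (u : Hs d s) : u.toL2 =ᵐ[volume] fun x => ev x u := by
  have h := fourierInv_toLp_ae_eq u.integrable_hat u.memLp_hat
  have htoLp : u.memLp_hat.toLp u.hat = (𝓕 u.toL2 : L2 d) := Lp.toLp_coeFn _ _
  rwa [htoLp, FourierTransform.fourierInv_fourier_eq] at h

theorem ext_ev {u v : Hs d s} (h : ∀ x, ev x u = ev x v) : u = v := by
  refine toL2_injective (Lp.ext ?_)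
  filter_upwards [toL2_ae_eq u, toL2_ae_eq v] with x hu hv
  rw [hu, hv, h]

end Evaluation

section Conj

variable {d : ℕ} {s : ℝ}

theorem eLpNorm_weighted_hat_conj (u : Hs d s) :
    eLpNorm (weighted s fun ξ => starRingEnd ℂ (u.hat (-ξ))) 2 volume
      = eLpNorm (weighted s u.hat) 2 volume := by
  rw [weighted_conj_comp_neg, ← eLpNorm_comp_measurePreserving u.memLp_weighted_hat.1
    (Measure.measurePreserving_neg volume)]
  exact eLpNorm_congr_norm_ae (ae_of_all _ fun ξ => RCLike.norm_conj _)

theorem memLp_weighted_hat_conj (u : Hs d s) :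
    MemLp (weighted s fun ξ => starRingEnd ℂ (u.hat (-ξ))) 2 := by
  refine ⟨?_, (eLpNorm_weighted_hat_conj u).trans_lt u.memLp_weighted_hat.2⟩
  rw [weighted_conj_comp_neg]
  exact Complex.continuous_conj.comp_aestronglyMeasurable
    (u.memLp_weighted_hat.1.comp_measurePreserving (Measure.measurePreserving_neg volume))

variable [Fact ((d : ℝ) / 2 < s)]

/-- The complex conjugate of `u`, whose Fourier transform is `ξ ↦ conj û(-ξ)`. -/
def conj (u : Hs d s) : Hs d s := ofHat (order_nonneg d s) u.memLp_weighted_hat_conj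

theorem norm_conj (u : Hs d s) : ‖conj u‖ = ‖u‖ := by
  rw [conj, norm_ofHat, eLpNorm_weighted_hat_conj, norm_eq_eLpNorm_weighted_hat]

theorem ev_conj (x : Rd d) (u : Hs d s) : ev x (conj u) = starRingEnd ℂ (ev x u) := by
  rw [conj, ev_ofHat, fourierInv_conj_comp_neg, ev_apply]

end Conj

section Product

open scoped Convolution

variable {d : ℕ} {s : ℝ} [Fact ((d : ℝ) / 2 < s)]

/-- The pointwise product, as the function whose Fourier transform is the convolution. -/
def mulFun (φ u : Hs d s) : Hs d s :=
  ofHat (order_nonneg d s) (memLp_weighted_convolution finrank_Rd_div_two_lt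
    φ.memLp_weighted_hat u.memLp_weighted_hat)

theorem ev_mulFun (x : Rd d) (φ u : Hs d s) : ev x (mulFun φ u) = ev x φ * ev x u := by
  rw [mulFun, ev_ofHat, fourierInv_convolution φ.integrable_hat u.integrable_hat, ev_apply,
    ev_apply]

theorem enorm_smul_add_mulFun (c : ℂ) (φ u : Hs d s) :
    ‖c • u + mulFun φ u‖ₑ =
      eLpNorm (weighted s (c • u.hat + φ.hat ⋆[ContinuousLinearMap.mul ℂ ℂ] u.hat)) 2 volume := by
  rw [enorm_eq_eLpNorm_weighted_hat]
  exact eLpNorm_congr_ae (weighted_congr_ae s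
    ((hat_add _ _).trans ((hat_smul c u).add (hat_ofHat _ _))))

variable (d s) in
theorem exists_norm_smul_add_mulFun_le : ∃ (C : ℝ≥0) (m : ℕ), ∀ (φ u : Hs d s) (c : ℂ) (M ε : ℝ),
    (∀ x, ‖c + ev x φ‖ ≤ M) → 0 < ε →
      ‖c • u + mulFun φ u‖ ≤ M * ‖u‖ + C * (‖φ‖ * (ε * ‖u‖ + ε⁻¹ ^ m * ‖u.toL2‖)) := by
  obtain ⟨C, m, h⟩ := exists_eLpNorm_weighted_smul_add_convolution_le (Rd d)
    (finrank_Rd_div_two_lt (s := s))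
  refine ⟨C, m, fun φ u c M ε hM hε => ?_⟩
  have hM0 : 0 ≤ M := (norm_nonneg _).trans (hM 0)
  have hen := h φ.hat u.hat c M ε φ.memLp_weighted_hat u.memLp_weighted_hat hM hε
  rw [← enorm_smul_add_mulFun, ← enorm_eq_eLpNorm_weighted_hat, ← enorm_eq_eLpNorm_weighted_hat,
    ← enorm_toL2] at hen
  rw [← ENNReal.ofReal_le_ofReal_iff (by positivity)]
  simpa (disch := positivity) only [ENNReal.ofReal_add, ENNReal.ofReal_mul, ofReal_norm,
    ENNReal.ofReal_coe_nnreal] using hen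

variable (d s) in
theorem exists_norm_mulFun_le : ∃ C : ℝ, ∀ φ u : Hs d s, ‖mulFun φ u‖ ≤ C * ‖φ‖ * ‖u‖ := by
  obtain ⟨C, m, h⟩ := exists_norm_smul_add_mulFun_le d s
  refine ⟨embeddingConst d s + 2 * C, fun φ u => ?_⟩
  have hφu := h φ u 0 (embeddingConst d s * ‖φ‖) 1
    (fun x => (zero_add (ev x φ)).symm ▸ norm_ev_le x φ) one_pos
  rw [zero_smul, zero_add, inv_one, one_pow, one_mul, one_mul] at hφu
  calc ‖mulFun φ u‖ ≤ embeddingConst d s * ‖φ‖ * ‖u‖ + C * (‖φ‖ * (‖u‖ + ‖u.toL2‖)) := hφu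
    _ ≤ embeddingConst d s * ‖φ‖ * ‖u‖ + C * (‖φ‖ * (‖u‖ + ‖u‖)) := by
        gcongr
        exact norm_toL2_le (order_nonneg d s) u
    _ = (embeddingConst d s + 2 * C) * ‖φ‖ * ‖u‖ := by ring

/-- The pointwise product as a bounded bilinear map on `H^s`. -/
def mul : Hs d s →L[ℂ] Hs d s →L[ℂ] Hs d s :=
  LinearMap.mkContinuousOfExistsBound₂
    (LinearMap.mk₂ ℂ mulFun
      (fun φ ψ u => ext_ev fun x => by simp only [map_add, ev_mulFun, add_mul])
      (fun c φ u => ext_ev fun x => by simp only [map_smul, ev_mulFun, smul_mul_assoc])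
      (fun φ u v => ext_ev fun x => by simp only [map_add, ev_mulFun, mul_add])
      (fun c φ u => ext_ev fun x => by simp only [map_smul, ev_mulFun, mul_smul_comm]))
    (exists_norm_mulFun_le d s)

theorem ev_mul (x : Rd d) (φ u : Hs d s) : ev x (mul φ u) = ev x φ * ev x u := ev_mulFun x φ u

end Product

end Hs

section ExpIteration

theorem apply_exp_apply_of_eigenfunctional {V : Type*} [NormedAddCommGroup V] [NormedSpace ℂ V]
    [CompleteSpace V] {T : V →L[ℂ] V} {ℓ : V →L[ℂ] ℂ} {c : ℂ} (h : ∀ v, ℓ (T v) = c * ℓ v)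
    (v : V) : ℓ (NormedSpace.exp T v) = Complex.exp c * ℓ v := by
  have hpow (n : ℕ) : ℓ ((T ^ n) v) = c ^ n * ℓ v := by
    induction n with
    | zero => simp only [pow_zero, one_apply_eq_self, one_mul]
    | succ n ih => rw [pow_succ', mul_apply_eq_comp, h, ih, pow_succ', mul_assoc]
  have hT := ((NormedSpace.exp_series_hasSum_exp' (𝕂 := ℂ) T).mapL
    (ContinuousLinearMap.apply ℂ V v)).mapL ℓ
  have hc := (NormedSpace.exp_series_hasSum_exp' (𝕂 := ℂ) c).mul_right (ℓ v)
  rw [← Complex.exp_eq_exp_ℂ] at hc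
  refine hT.unique (hc.congr_fun fun n => ?_)
  simp only [ContinuousLinearMap.apply_apply, map_smul, hpow, smul_mul_assoc]

theorem norm_iterate_le {V : Type*} [SeminormedAddGroup V] {T : V → V} {p : V → ℝ} {α β : ℝ}
    (hα : 0 ≤ α) (hβ : 0 ≤ β) (hp0 : ∀ v, 0 ≤ p v) (hp : ∀ v, p (T v) = p v)
    (hT : ∀ v, ‖T v‖ ≤ (1 + α) * ‖v‖ + β * p v) (v : V) (n : ℕ) :
    ‖T^[n] v‖ ≤ (‖v‖ + n * (β * p v)) * Real.exp (n * α) := by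
  have hpn (k : ℕ) : p (T^[k] v) = p v := by
    induction k with
    | zero => rfl
    | succ k ih => rw [Function.iterate_succ_apply', hp, ih]
  have h := discrete_gronwall (u := fun k => ‖T^[k] v‖) (c := fun _ => α) (b := fun _ => β * p v)
    (norm_nonneg _) (fun k _ => by
      simpa only [Function.iterate_succ_apply', hpn] using hT (T^[k] v))
    (fun _ _ => hα) (fun _ _ => mul_nonneg hβ (hp0 v)) n.zero_le
  simpa using h

end ExpIteration

namespace Hs

section Exp

variable {d : ℕ} {s : ℝ} [Fact ((d : ℝ) / 2 < s)]

/-- Multiplication by `e^φ` on `H^s`. -/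
def expMul (φ : Hs d s) : Hs d s →L[ℂ] Hs d s := NormedSpace.exp (mul φ)

theorem ev_expMul (x : Rd d) (φ u : Hs d s) :
    ev x (expMul φ u) = Complex.exp (ev x φ) * ev x u :=
  apply_exp_apply_of_eigenfunctional (ev_mul x φ) u

theorem continuous_expMul : Continuous (expMul : Hs d s → Hs d s →L[ℂ] Hs d s) :=
  let _ : NormedAlgebra ℚ (Hs d s →L[ℂ] Hs d s) := .restrictScalars ℚ ℂ _
  NormedSpace.exp_continuous.comp (ContinuousLinearMap.continuous _)

theorem expMul_nsmul (n : ℕ) (φ : Hs d s) : expMul (n • φ) = expMul φ ^ n := by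
  let _ : NormedAlgebra ℚ (Hs d s →L[ℂ] Hs d s) := .restrictScalars ℚ ℂ _
  rw [expMul, map_nsmul, NormedSpace.exp_nsmul, expMul]

theorem iterate_expMul_inv_smul {n : ℕ} (hn : (n : ℝ) ≠ 0) (φ u : Hs d s) :
    (expMul ((n : ℝ)⁻¹ • φ))^[n] u = expMul φ u := by
  conv_rhs => rw [← smul_inv_smul₀ hn φ, Nat.cast_smul_eq_nsmul, expMul_nsmul]
  exact congrFun (FunLike.coe_pow_eq_iterate _ n).symm u

/-- The element `e^φ - 1` of `H^s`, written as `∫₀¹ e^{tφ} φ dt` since `1 ∉ H^s`. -/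
def expm1 (φ : Hs d s) : Hs d s := ∫ t in (0 : ℝ)..1, expMul (t • φ) φ

theorem ev_expm1 (x : Rd d) (φ : Hs d s) : ev x (expm1 φ) = Complex.exp (ev x φ) - 1 := by
  have hcont : Continuous fun t : ℝ => expMul (t • φ) φ :=
    (continuous_expMul.comp (by fun_prop)).clm_apply continuous_const
  have hderiv (t : ℝ) : HasDerivAt (fun t : ℝ => Complex.exp (t * ev x φ))
      (Complex.exp (t * ev x φ) * ev x φ) t := by
    simpa using ((Complex.ofRealCLM.hasDerivAt (x := t)).mul_const (ev x φ)).cexp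
  rw [expm1, ← ContinuousLinearMap.intervalIntegral_comp_comm _ (hcont.intervalIntegrable 0 1)]
  simp only [ev_expMul, ContinuousLinearMap.map_smul_of_tower, Complex.real_smul]
  rw [intervalIntegral.integral_eq_sub_of_hasDerivAt (fun t _ => hderiv t)
    (Continuous.intervalIntegrable (by fun_prop) 0 1)]
  simp

theorem expm1_zero : expm1 (0 : Hs d s) = 0 := by
  simp only [expm1, map_zero, intervalIntegral.integral_zero]

theorem norm_expm1_le {φ : Hs d s} {L : ℝ} (h : ∀ t ∈ Set.Ioc (0 : ℝ) 1, ‖expMul (t • φ)‖ ≤ L) :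
    ‖expm1 φ‖ ≤ L * ‖φ‖ := by
  have hbound : ∀ t ∈ Set.uIoc (0 : ℝ) 1, ‖expMul (t • φ) φ‖ ≤ L * ‖φ‖ := fun t ht =>
    ContinuousLinearMap.le_of_opNorm_le _ (h t (Set.uIoc_of_le (zero_le_one' ℝ) ▸ ht)) φ
  simpa only [expm1, sub_zero, abs_one, mul_one] using
    intervalIntegral.norm_integral_le_of_norm_le_const hbound

theorem expMul_eq_add_mul_expm1 (φ u : Hs d s) : expMul φ u = (1 : ℂ) • u + mul (expm1 φ) u := by
  refine ext_ev fun x => ?_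
  rw [map_add, map_smul, ev_mul, ev_expMul, ev_expm1, one_smul]
  ring

theorem expm1_sub_expm1 (φ ψ : Hs d s) : expm1 φ - expm1 ψ = expMul ψ (expm1 (φ - ψ)) := by
  refine ext_ev fun x => ?_
  rw [map_sub, ev_expMul, ev_expm1, ev_expm1, ev_expm1, map_sub, Complex.exp_sub]
  field_simp [Complex.exp_ne_zero]
  ring

variable (d s) in
theorem exists_norm_expm1_le_of_norm_le :
    ∃ δ > 0, ∀ φ : Hs d s, ‖φ‖ ≤ δ → ‖expm1 φ‖ ≤ 2 * ‖φ‖ := by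
  have h0 : ‖expMul (0 : Hs d s)‖ < 2 := by
    rw [expMul, map_zero, NormedSpace.exp_zero]
    exact ContinuousLinearMap.norm_id_le.trans_lt one_lt_two
  obtain ⟨δ, hδ, h⟩ := Metric.nhds_basis_closedBall.eventually_iff.1
    (continuous_expMul.norm.continuousAt.eventually_lt continuousAt_const h0)
  refine ⟨δ, hδ, fun φ hφ => norm_expm1_le fun t ht => (h ?_).le⟩
  rw [mem_closedBall_zero_iff, norm_smul, Real.norm_of_nonneg ht.1.le]
  exact (mul_le_of_le_one_left (norm_nonneg φ) ht.2).trans hφ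

end Exp

section Imaginary

variable {d : ℕ} {s : ℝ} [Fact ((d : ℝ) / 2 < s)] {φ ψ : Hs d s}

theorem norm_exp_ev (hφ : ∀ x, (ev x φ).re = 0) (x : Rd d) : ‖Complex.exp (ev x φ)‖ = 1 := by
  rw [Complex.norm_exp, hφ, Real.exp_zero]

theorem norm_toL2_expMul (hφ : ∀ x, (ev x φ).re = 0) (u : Hs d s) :
    ‖(expMul φ u).toL2‖ = ‖u.toL2‖ := by
  rw [Lp.norm_def, Lp.norm_def]
  refine congrArg _ (eLpNorm_congr_norm_ae ?_)
  filter_upwards [toL2_ae_eq u, toL2_ae_eq (expMul φ u)] with x hu hφu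
  rw [hu, hφu, ev_expMul, norm_mul, norm_exp_ev hφ, one_mul]

theorem re_ev_smul (hφ : ∀ x, (ev x φ).re = 0) (t : ℝ) (x : Rd d) : (ev x (t • φ)).re = 0 := by
  rw [ContinuousLinearMap.map_smul_of_tower, Complex.smul_re, hφ, smul_zero]

variable (d s) in
/-- Since `|e^φ| = 1`, multiplication by `e^φ` increases the `H^s` norm only through its
commutator with the weight, which is of lower order. -/
theorem exists_norm_expMul_apply_le : ∃ (C : ℝ≥0) (m : ℕ), ∃ δ > 0, ∀ φ : Hs d s,
    (∀ x, (ev x φ).re = 0) → ‖φ‖ ≤ δ → ∀ (u : Hs d s) (ε : ℝ), 0 < ε →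
      ‖expMul φ u‖ ≤ (1 + C * ‖φ‖ * ε) * ‖u‖ + C * ‖φ‖ * ε⁻¹ ^ m * ‖u.toL2‖ := by
  obtain ⟨C, m, hC⟩ := exists_norm_smul_add_mulFun_le d s
  obtain ⟨δ, hδ, hexp⟩ := exists_norm_expm1_le_of_norm_le d s
  refine ⟨2 * C, m, δ, hδ, fun φ hφ hφδ u ε hε => ?_⟩
  have hunit (x : Rd d) : ‖1 + ev x (expm1 φ)‖ ≤ 1 := by
    rw [ev_expm1, add_sub_cancel, norm_exp_ev hφ]
  calc ‖expMul φ u‖ ≤ 1 * ‖u‖ + C * (‖expm1 φ‖ * (ε * ‖u‖ + ε⁻¹ ^ m * ‖u.toL2‖)) :=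
        expMul_eq_add_mul_expm1 φ u ▸ hC (expm1 φ) u 1 1 ε hunit hε
    _ ≤ 1 * ‖u‖ + C * (2 * ‖φ‖ * (ε * ‖u‖ + ε⁻¹ ^ m * ‖u.toL2‖)) := by
        gcongr
        exact hexp φ hφδ
    _ = _ := by
        push_cast
        ring

variable (d s) in
/-- The smallness of `φ` is removed by writing `e^φ` as the power `(e^{φ/n})^n`. -/
theorem exists_norm_expMul_apply_le_mul_exp : ∃ (C : ℝ≥0) (m : ℕ), ∀ φ : Hs d s,
    (∀ x, (ev x φ).re = 0) → ∀ (u : Hs d s) (ε : ℝ), 0 < ε →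
      ‖expMul φ u‖ ≤
        (‖u‖ + C * ‖φ‖ * ε⁻¹ ^ m * ‖u.toL2‖) * Real.exp (C * ‖φ‖ * ε) := by
  obtain ⟨C, m, δ, hδ, h⟩ := exists_norm_expMul_apply_le d s
  refine ⟨C, m, fun φ hφ u ε hε => ?_⟩
  obtain ⟨n, hn⟩ := exists_nat_gt (‖φ‖ / δ)
  have hn0 : (0 : ℝ) < n := (by positivity : 0 ≤ ‖φ‖ / δ).trans_lt hn
  let ψ : Hs d s := (n : ℝ)⁻¹ • φ
  have hψ : ‖ψ‖ = (n : ℝ)⁻¹ * ‖φ‖ := by rw [norm_smul, Real.norm_of_nonneg (by positivity)]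
  have hψδ : ‖ψ‖ ≤ δ := by
    rw [hψ, inv_mul_le_iff₀ hn0, ← div_le_iff₀ hδ]
    exact hn.le
  have hscale (r : ℝ) : n * (C * ‖ψ‖ * r) = C * ‖φ‖ * r := by
    rw [hψ]
    field_simp
  have hiter := norm_iterate_le (T := expMul ψ) (p := fun v => ‖v.toL2‖)
    (α := C * ‖ψ‖ * ε) (β := C * ‖ψ‖ * ε⁻¹ ^ m) (by positivity) (by positivity)
    (fun v => norm_nonneg _) (norm_toL2_expMul (re_ev_smul hφ _))
    (fun v => h ψ (re_ev_smul hφ _) hψδ v ε hε) u n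
  rwa [iterate_expMul_inv_smul hn0.ne', ← mul_assoc (n : ℝ) (_ * _), hscale, hscale] at hiter

variable (d s) in
theorem exists_norm_expMul_le : ∃ (K : ℝ≥0) (N : ℕ), ∀ φ : Hs d s,
    (∀ x, (ev x φ).re = 0) → ‖expMul φ‖ ≤ K * (1 + ‖φ‖) ^ N := by
  obtain ⟨C, m, h⟩ := exists_norm_expMul_apply_le_mul_exp d s
  refine ⟨3 * (1 + C) ^ (m + 1), m + 1, fun φ hφ =>
    ContinuousLinearMap.opNorm_le_bound _ (by positivity) fun u => ?_⟩
  let y := C * ‖φ‖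
  have hy : 0 ≤ y := by positivity
  have hexp : Real.exp (y * (1 + y)⁻¹) ≤ 3 := by
    refine (Real.exp_le_exp.2 ?_).trans Real.exp_one_lt_three.le
    exact mul_inv_le_one_of_le₀ (le_add_of_nonneg_left zero_le_one) (by positivity)
  calc ‖expMul φ u‖ ≤ (‖u‖ + y * (1 + y) ^ m * ‖u.toL2‖) * Real.exp (y * (1 + y)⁻¹) := by
        simpa only [inv_inv] using h φ hφ u (1 + y)⁻¹ (by positivity)
    _ ≤ ((1 + y) ^ m * ‖u‖ + y * (1 + y) ^ m * ‖u‖) * 3 := by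
        gcongr
        · exact le_mul_of_one_le_left (norm_nonneg u)
            (one_le_pow₀ (le_add_of_nonneg_right hy))
        · exact norm_toL2_le (order_nonneg d s) u
    _ = 3 * (1 + C * ‖φ‖) ^ (m + 1) * ‖u‖ := by ring
    _ ≤ 3 * ((1 + C) * (1 + ‖φ‖)) ^ (m + 1) * ‖u‖ := by
        gcongr
        nlinarith [norm_nonneg φ, C.coe_nonneg]
    _ = _ := by
        rw [mul_pow]
        push_cast
        ring

variable (d s) in
theorem exists_norm_expm1_sub_expm1_le : ∃ (K : ℝ≥0) (N : ℕ), ∀ φ ψ : Hs d s,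
    (∀ x, (ev x φ).re = 0) → (∀ x, (ev x ψ).re = 0) →
      ‖expm1 φ - expm1 ψ‖ ≤ K * (1 + ‖φ‖ + ‖ψ‖) ^ N * ‖φ - ψ‖ := by
  obtain ⟨K, N, h⟩ := exists_norm_expMul_le d s
  refine ⟨K * K, N + N, fun φ ψ hφ hψ => ?_⟩
  have hsub (x : Rd d) : (ev x (φ - ψ)).re = 0 := by rw [map_sub, Complex.sub_re, hφ, hψ, sub_zero]
  have hexp : ‖expm1 (φ - ψ)‖ ≤ K * (1 + ‖φ‖ + ‖ψ‖) ^ N * ‖φ - ψ‖ := by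
    refine norm_expm1_le fun t ht => (h _ (re_ev_smul hsub t)).trans ?_
    rw [norm_smul, Real.norm_of_nonneg ht.1.le, add_assoc]
    have htsub := (mul_le_of_le_one_left (norm_nonneg (φ - ψ)) ht.2).trans (norm_sub_le φ ψ)
    have ht0 : 0 ≤ t * ‖φ - ψ‖ := mul_nonneg ht.1.le (norm_nonneg _)
    gcongr
  calc ‖expm1 φ - expm1 ψ‖ ≤ ‖expMul ψ‖ * ‖expm1 (φ - ψ)‖ := by
        rw [expm1_sub_expm1]
        exact (expMul ψ).le_opNorm _
    _ ≤ K * (1 + ‖φ‖ + ‖ψ‖) ^ N * (K * (1 + ‖φ‖ + ‖ψ‖) ^ N * ‖φ - ψ‖) := by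
        gcongr
        refine (h ψ hψ).trans ?_
        gcongr
        linarith [norm_nonneg φ]
    _ = _ := by
        push_cast
        ring

end Imaginary

end Hs

section Schwartz

variable {E F : Type*} [NormedAddCommGroup E] [NormedSpace ℝ E] [NormedAddCommGroup F]
  [NormedSpace ℝ F]

theorem integrable_one_add_norm_pow_mul_norm [MeasurableSpace E] [BorelSpace E]
    [SecondCountableTopology E] {μ : Measure E} [μ.HasTemperateGrowth] (g : 𝓢(E, F)) (N : ℕ) :
    Integrable (fun x => (1 + ‖x‖) ^ N * ‖g x‖) μ := by
  refine (((g.integrable_pow_mul μ 0).add (g.integrable_pow_mul μ N)).const_mul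
    (2 ^ (N - 1))).mono' (Continuous.aestronglyMeasurable (by fun_prop)) (.of_forall fun x => ?_)
  rw [Real.norm_of_nonneg (by positivity)]
  calc (1 + ‖x‖) ^ N * ‖g x‖ ≤ 2 ^ (N - 1) * (1 ^ N + ‖x‖ ^ N) * ‖g x‖ := by
        gcongr
        exact add_pow_le zero_le_one (norm_nonneg x) N
    _ = 2 ^ (N - 1) * (‖x‖ ^ 0 * ‖g x‖ + ‖x‖ ^ N * ‖g x‖) := by ring

theorem exists_schwartzMap_eqOn_closedBall [FiniteDimensional ℝ E] {f : E → F}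
    (hf : ContDiff ℝ ∞ f) (R : ℝ) : ∃ g : 𝓢(E, F), Set.EqOn g f (Metric.closedBall 0 R) := by
  let χ : ContDiffBump (0 : E) := ⟨|R| + 1, |R| + 2, by positivity, by linarith⟩
  have hsupp : HasCompactSupport fun x => χ x • f x := χ.hasCompactSupport.smul_right
  refine ⟨hsupp.toSchwartzMap (χ.contDiff.smul hf), fun x hx => ?_⟩
  have hχ : χ x = 1 := χ.one_of_mem_closedBall
    (Metric.closedBall_subset_closedBall ((le_abs_self R).trans (lt_add_one _).le) hx)
  rw [hsupp.toSchwartzMap_toFun, hχ, one_smul]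

section Inversion

variable {V : Type*} [NormedAddCommGroup V] [InnerProductSpace ℝ V] [FiniteDimensional ℝ V]
  [MeasurableSpace V] [BorelSpace V]

theorem integrable_fourierChar_smul_fourier (g : 𝓢(V, ℂ)) (x : V) :
    Integrable fun ξ => Real.fourierChar (inner ℝ ξ x) • 𝓕 g ξ := by
  simpa only [inner_neg_right, neg_neg] using
    (Real.fourierIntegral_convergent_iff (-x)).2 (𝓕 g).integrable

theorem integral_fourierChar_smul_fourier (g : 𝓢(V, ℂ)) (x : V) :
    ∫ ξ, Real.fourierChar (inner ℝ ξ x) • 𝓕 g ξ = g x := by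
  rw [← Real.fourierInv_eq, ← SchwartzMap.fourierInv_coe, FourierTransform.fourierInv_fourier_eq]

end Inversion

end Schwartz

namespace Hs

section Composition

variable {d : ℕ} {s : ℝ} [Fact ((d : ℝ) / 2 < s)]

/-- The element `2πi⟨u, ζ⟩` of `H^s`, where `⟨z, ζ⟩ = Re (z ζ̄)` is the real inner product of `ℂ`
which enters the Fourier transform of functions of a complex variable. -/
def phase (ζ : ℂ) (u : Hs d s) : Hs d s :=
  (Real.pi * Complex.I * starRingEnd ℂ ζ) • u + (Real.pi * Complex.I * ζ) • conj u

theorem ev_phase (x : Rd d) (ζ : ℂ) (u : Hs d s) :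
    ev x (phase ζ u) = (2 * Real.pi * inner ℝ (ev x u) ζ : ℝ) * Complex.I := by
  have hre := Complex.add_conj (ζ * starRingEnd ℂ (ev x u))
  rw [map_mul, Complex.conj_conj] at hre
  rw [phase, map_add, map_smul, map_smul, ev_conj, smul_eq_mul, smul_eq_mul, Complex.inner]
  push_cast at hre ⊢
  linear_combination Real.pi * Complex.I * hre

theorem re_ev_phase (x : Rd d) (ζ : ℂ) (u : Hs d s) : (ev x (phase ζ u)).re = 0 := by
  rw [ev_phase, Complex.re_ofReal_mul, Complex.I_re, mul_zero]

theorem norm_phase_le (ζ : ℂ) (u : Hs d s) : ‖phase ζ u‖ ≤ 2 * Real.pi * ‖ζ‖ * ‖u‖ := by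
  refine (norm_add_le _ _).trans_eq ?_
  rw [norm_smul, norm_smul, norm_conj]
  simp only [norm_mul, Complex.norm_real, Real.norm_of_nonneg Real.pi_pos.le, Complex.norm_I,
    RCLike.norm_conj]
  ring

theorem phase_sub (ζ : ℂ) (u v : Hs d s) : phase ζ (u - v) = phase ζ u - phase ζ v := by
  refine ext_ev fun x => ?_
  simp only [map_sub, ev_phase, inner_sub_left]
  push_cast
  ring

theorem phase_zero (ζ : ℂ) : phase ζ (0 : Hs d s) = 0 :=
  norm_le_zero_iff.1 ((norm_phase_le ζ 0).trans_eq (by rw [norm_zero, mul_zero]))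

theorem continuous_expm1_phase (u : Hs d s) : Continuous fun ζ : ℂ => expm1 (phase ζ u) := by
  have hphase : Continuous fun p : ℂ × ℝ => phase p.1 u := by
    unfold phase
    fun_prop
  exact intervalIntegral.continuous_parametric_intervalIntegral_of_continuous'
    ((continuous_expMul.comp (continuous_snd.smul hphase)).clm_apply hphase) 0 1

variable (d s) in
theorem exists_norm_expm1_phase_sub_le (R : ℝ≥0) : ∃ (A : ℝ≥0) (N : ℕ), ∀ (ζ : ℂ) (u v : Hs d s),
    ‖u‖ ≤ R → ‖v‖ ≤ R →
      ‖expm1 (phase ζ u) - expm1 (phase ζ v)‖ ≤ A * (1 + ‖ζ‖) ^ N * ‖u - v‖ := by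
  obtain ⟨K, N, h⟩ := exists_norm_expm1_sub_expm1_le d s
  refine ⟨K * (1 + 4 * NNReal.pi * R) ^ N * (2 * NNReal.pi), N + 1, fun ζ u v hu hv => ?_⟩
  have hle {w : Hs d s} (hw : ‖w‖ ≤ R) : ‖phase ζ w‖ ≤ 2 * Real.pi * ‖ζ‖ * R :=
    (norm_phase_le ζ w).trans (by gcongr)
  have hsum : 1 + ‖phase ζ u‖ + ‖phase ζ v‖ ≤ (1 + 4 * Real.pi * R) * (1 + ‖ζ‖) := by
    have : 0 ≤ 4 * Real.pi * R := by positivity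
    linarith [hle hu, hle hv, norm_nonneg ζ]
  calc ‖expm1 (phase ζ u) - expm1 (phase ζ v)‖
      ≤ K * (1 + ‖phase ζ u‖ + ‖phase ζ v‖) ^ N * ‖phase ζ (u - v)‖ :=
        phase_sub ζ u v ▸ h _ _ (fun x => re_ev_phase x ζ u) fun x => re_ev_phase x ζ v
    _ ≤ K * ((1 + 4 * Real.pi * R) * (1 + ‖ζ‖)) ^ N * (2 * Real.pi * (1 + ‖ζ‖) * ‖u - v‖) := by
        gcongr
        refine (norm_phase_le ζ _).trans ?_
        gcongr
        exact le_add_of_nonneg_left zero_le_one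
    _ = _ := by
        rw [mul_pow]
        push_cast [NNReal.coe_real_pi]
        ring

theorem integrable_smul_expm1_phase (g : 𝓢(ℂ, ℂ)) (u : Hs d s) :
    Integrable fun ζ => g ζ • expm1 (phase ζ u) := by
  obtain ⟨A, N, h⟩ := exists_norm_expm1_phase_sub_le d s ‖u‖₊
  refine ((integrable_one_add_norm_pow_mul_norm g N).mul_const (A * ‖u‖)).mono'
    (g.continuous.smul (continuous_expm1_phase u)).aestronglyMeasurable (.of_forall fun ζ => ?_)
  have hu : ‖expm1 (phase ζ u)‖ ≤ A * (1 + ‖ζ‖) ^ N * ‖u‖ := by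
    simpa only [phase_zero, expm1_zero, sub_zero] using h ζ u 0 le_rfl (by simp)
  calc ‖g ζ • expm1 (phase ζ u)‖ ≤ ‖g ζ‖ * (A * (1 + ‖ζ‖) ^ N * ‖u‖) := by
        rw [norm_smul]
        gcongr
    _ = (1 + ‖ζ‖) ^ N * ‖g ζ‖ * (A * ‖u‖) := by ring

/-- The element `g ∘ u - g(0)` of `H^s` for a Schwartz function `g`, written by Fourier inversion
as a superposition of the functions `e^{2πi⟨u, ζ⟩} - 1`. -/
def schwartzComp (g : 𝓢(ℂ, ℂ)) (u : Hs d s) : Hs d s := ∫ ζ, 𝓕 g ζ • expm1 (phase ζ u)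

theorem ev_schwartzComp (x : Rd d) (g : 𝓢(ℂ, ℂ)) (u : Hs d s) :
    ev x (schwartzComp g u) = g (ev x u) - g 0 := by
  rw [schwartzComp, ← ContinuousLinearMap.integral_comp_comm _ (integrable_smul_expm1_phase _ u),
    ← integral_fourierChar_smul_fourier g (ev x u), ← integral_fourierChar_smul_fourier g 0,
    ← integral_sub (integrable_fourierChar_smul_fourier g _)
      (integrable_fourierChar_smul_fourier g 0)]
  refine integral_congr_ae (.of_forall fun ζ => ?_)
  simp only [map_smul, smul_eq_mul, ev_expm1, ev_phase, Circle.smul_def, Real.fourierChar_apply,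
    inner_zero_right, mul_zero, Complex.ofReal_zero, zero_mul, Complex.exp_zero,
    real_inner_comm ζ (ev x u)]
  ring

theorem exists_lipschitzOnWith_schwartzComp (g : 𝓢(ℂ, ℂ)) (R : ℝ≥0) :
    ∃ K, LipschitzOnWith K (schwartzComp g : Hs d s → Hs d s) (Metric.closedBall 0 R) := by
  obtain ⟨A, N, h⟩ := exists_norm_expm1_phase_sub_le d s R
  refine ⟨_, LipschitzOnWith.of_dist_le' (K := (∫ ζ, (1 + ‖ζ‖) ^ N * ‖𝓕 g ζ‖) * A)
    fun u hu v hv => ?_⟩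
  rw [mem_closedBall_zero_iff] at hu hv
  rw [dist_eq_norm, dist_eq_norm, schwartzComp, schwartzComp,
    ← integral_sub (integrable_smul_expm1_phase _ u) (integrable_smul_expm1_phase _ v), mul_assoc,
    ← integral_mul_const]
  refine norm_integral_le_of_norm_le
    ((integrable_one_add_norm_pow_mul_norm (𝓕 g) N).mul_const _) (.of_forall fun ζ => ?_)
  calc ‖𝓕 g ζ • expm1 (phase ζ u) - 𝓕 g ζ • expm1 (phase ζ v)‖
      ≤ ‖𝓕 g ζ‖ * (A * (1 + ‖ζ‖) ^ N * ‖u - v‖) := by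
        rw [← smul_sub, norm_smul]
        gcongr
        exact h ζ u v hu hv
    _ = (1 + ‖ζ‖) ^ N * ‖𝓕 g ζ‖ * (A * ‖u - v‖) := by ring

theorem ev_mem_closedBall {u : Hs d s} {R : ℝ} (hu : ‖u‖ ≤ R) (x : Rd d) :
    ev x u ∈ Metric.closedBall 0 (embeddingConst d s * R) :=
  mem_closedBall_zero_iff.2 ((norm_ev_le x u).trans
    (mul_le_mul_of_nonneg_left hu (embeddingConst_nonneg d s)))

theorem exists_ev_schwartzComp_eq {f : ℂ → ℂ} (hf : ContDiff ℝ ∞ f) (hf0 : f 0 = 0) (R : ℝ) :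
    ∃ g : 𝓢(ℂ, ℂ), ∀ u : Hs d s, ‖u‖ ≤ R → ∀ x, ev x (schwartzComp g u) = f (ev x u) := by
  obtain ⟨g, hg⟩ := exists_schwartzMap_eqOn_closedBall hf (embeddingConst d s * R)
  refine ⟨g, fun u hu x => ?_⟩
  have h0 : (0 : ℂ) ∈ Metric.closedBall 0 (embeddingConst d s * R) :=
    Metric.mem_closedBall_self (mul_nonneg (embeddingConst_nonneg d s) ((norm_nonneg u).trans hu))
  rw [ev_schwartzComp, hg (ev_mem_closedBall hu x), hg h0, hf0, sub_zero]

variable (d s) in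
theorem exists_ev_eq_and_lipschitzOnWith {f : ℂ → ℂ} (hf : ContDiff ℝ ∞ f) (hf0 : f 0 = 0) :
    ∃ B : Hs d s → Hs d s, (∀ u x, ev x (B u) = f (ev x u)) ∧
      ∀ R : ℝ≥0, ∃ K, LipschitzOnWith K B (Metric.closedBall 0 R) := by
  choose g hg using exists_ev_schwartzComp_eq (d := d) (s := s) hf hf0
  have hev (u : Hs d s) : ∀ x, ev x (schwartzComp (g ‖u‖) u) = f (ev x u) := hg _ u le_rfl
  refine ⟨fun u => schwartzComp (g ‖u‖) u, hev, fun R => ?_⟩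
  obtain ⟨K, hK⟩ := exists_lipschitzOnWith_schwartzComp (d := d) (s := s) (g R) R
  have hEq : Set.EqOn (fun u => schwartzComp (g ‖u‖) u) (schwartzComp (g R))
      (Metric.closedBall (0 : Hs d s) R) := fun u hu => ext_ev fun x => by
    rw [hev, hg R u (mem_closedBall_zero_iff.1 hu)]
  refine ⟨K, fun u hu v hv => ?_⟩
  rw [hEq hu, hEq hv]
  exact hK hu hv

end Composition

end Hs

theorem exists_norm_sub_sub_fderiv_le {E F : Type*} [NormedAddCommGroup E] [NormedSpace ℝ E]
    [NormedAddCommGroup F] [NormedSpace ℝ F] {f : E → F} (hf : ContDiff ℝ 1 f) {K : Set E}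
    (hK : IsCompact K) {ε : ℝ} (hε : 0 < ε) :
    ∃ δ > 0, ∀ a ∈ K, ∀ b, ‖b‖ < δ → ‖f (a + b) - f a - fderiv ℝ f a b‖ ≤ ε * ‖b‖ := by
  obtain ⟨δ, hδ, h⟩ := Metric.mem_uniformity_dist.1 (hK.uniformContinuousAt_of_continuousAt _
    (fun _ _ => (hf.continuous_fderiv one_ne_zero).continuousAt) (Metric.dist_mem_uniformity hε))
  refine ⟨δ, hδ, fun a ha b hb => ?_⟩
  have hclose (z : E) (hz : z ∈ Metric.ball a δ) : ‖fderiv ℝ f z - fderiv ℝ f a‖ ≤ ε := by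
    rw [← dist_eq_norm, dist_comm]
    exact (h (Metric.mem_ball'.1 hz) ha).le
  simpa only [add_sub_cancel_left] using
    (convex_ball a δ).norm_image_sub_le_of_norm_hasFDerivWithin_le' (φ := fderiv ℝ f a)
      (fun z _ => (hf.differentiable one_ne_zero z).hasFDerivAt.hasFDerivWithinAt) hclose
      (Metric.mem_ball_self hδ) (y := a + b) (by simpa using hb)

section Multiplication

variable {α 𝕜 E F : Type*} [MeasurableSpace α] {μ : Measure α} [NontriviallyNormedField 𝕜]
  [NormedAddCommGroup E] [NormedSpace 𝕜 E] [NormedAddCommGroup F] [NormedSpace 𝕜 F]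
  {p : ℝ≥0∞} [Fact (1 ≤ p)] {ψ : α → E →L[𝕜] F} {C : ℝ}

variable (p) in
theorem exists_clm_ae_eq_apply (hψ : AEStronglyMeasurable ψ μ) (hC : ∀ᵐ x ∂μ, ‖ψ x‖ ≤ C) :
    ∃ T : Lp E p μ →L[𝕜] Lp F p μ, ∀ v, T v =ᵐ[μ] fun x => ψ x (v x) := by
  have hmem := memLp_top_of_bound hψ C hC
  refine ⟨(ContinuousLinearMap.id 𝕜 (E →L[𝕜] F)).holderL μ ⊤ p p hmem.toLp, fun v => ?_⟩
  filter_upwards [ContinuousLinearMap.coeFn_holder (r := p) (.id 𝕜 (E →L[𝕜] F)) hmem.toLp v,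
    hmem.coeFn_toLp] with x hT hx
  rw [ContinuousLinearMap.holderL_apply_apply, hT, hx, ContinuousLinearMap.id_apply]

theorem norm_le_of_ae_eq_apply {T : Lp E p μ →L[𝕜] Lp F p μ}
    (hT : ∀ v, T v =ᵐ[μ] fun x => ψ x (v x)) (hC0 : 0 ≤ C) (hC : ∀ᵐ x ∂μ, ‖ψ x‖ ≤ C) :
    ‖T‖ ≤ C := by
  refine T.opNorm_le_bound hC0 fun v => Lp.norm_le_mul_norm_of_ae_le_mul ?_
  filter_upwards [hT v, hC] with x hTx hx
  exact hTx ▸ (ψ x).le_of_opNorm_le hx (v x)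

end Multiplication

namespace Hs

variable {d : ℕ} {s : ℝ} [Fact ((d : ℝ) / 2 < s)] {f : ℂ → ℂ}

variable (d s) in
theorem exists_norm_fderiv_toL2_le (hf : ContDiff ℝ 1 f) (R : ℝ) :
    ∃ C > 0, ∀ u : Hs d s, ‖u‖ ≤ R → ∀ᵐ x, ‖fderiv ℝ f (u.toL2 x)‖ ≤ C := by
  obtain ⟨C, hC⟩ := (isCompact_closedBall 0 (embeddingConst d s * R)).exists_bound_of_continuousOn
    (hf.continuous_fderiv one_ne_zero).continuousOn
  refine ⟨max C 1, by positivity, fun u hu => ?_⟩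
  filter_upwards [toL2_ae_eq u] with x hx
  exact hx ▸ (hC _ (ev_mem_closedBall hu x)).trans (le_max_left _ _)

theorem exists_clm_ae_eq_fderiv (hf : ContDiff ℝ 1 f) (u : Hs d s) :
    ∃ T : L2 d →L[ℝ] L2 d, ∀ v, T v =ᵐ[volume] fun x => fderiv ℝ f (u.toL2 x) (v x) := by
  obtain ⟨C, -, hC⟩ := exists_norm_fderiv_toL2_le d s hf ‖u‖
  exact exists_clm_ae_eq_apply 2 ((hf.continuous_fderiv one_ne_zero).comp_aestronglyMeasurable
    (Lp.aestronglyMeasurable _)) (hC u le_rfl)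

theorem toL2_ae_eq_comp {u v : Hs d s} (h : ∀ x, ev x v = f (ev x u)) :
    v.toL2 =ᵐ[volume] fun x => f (u.toL2 x) := by
  filter_upwards [toL2_ae_eq u, toL2_ae_eq v] with x hu hv
  rw [hu, hv, h]

variable (d s) in
theorem exists_norm_toL2_sub_sub_fderiv_le (hf : ContDiff ℝ 1 f) (R : ℝ) {ε : ℝ} (hε : 0 < ε) :
    ∃ δ > 0, ∀ u w : Hs d s, ‖u‖ ≤ R → ‖w‖ < δ → ∀ᵐ x,
      ‖f ((u + w).toL2 x) - f (u.toL2 x) - fderiv ℝ f (u.toL2 x) (w.toL2 x)‖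
        ≤ ε * ‖w.toL2 x‖ := by
  have hE := embeddingConst_nonneg d s
  obtain ⟨δ, hδ, h⟩ := exists_norm_sub_sub_fderiv_le hf
    (isCompact_closedBall (0 : ℂ) (embeddingConst d s * R)) hε
  refine ⟨δ / (embeddingConst d s + 1), by positivity, fun u w hu hw => ?_⟩
  have hsmall (x : Rd d) : ‖ev x w‖ < δ := calc
    ‖ev x w‖ ≤ embeddingConst d s * ‖w‖ := norm_ev_le x w
    _ ≤ (embeddingConst d s + 1) * ‖w‖ := by gcongr; exact (lt_add_one _).le
    _ < δ := (lt_div_iff₀' (by positivity)).1 hw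
  filter_upwards [toL2_ae_eq u, toL2_ae_eq w, toL2_ae_eq (u + w)] with x hux hwx huwx
  rw [hux, hwx, huwx, map_add]
  exact h _ (ev_mem_closedBall hu x) _ (hsmall x)

end Hs

end LocalNonlinearity

end

theorem mainTheorem7 (d : ℕ) (s : ℝ) (hs : (d : ℝ) / 2 < s)
    (f : ℂ → ℂ) (hf : ContDiff ℝ ∞ f) (hf0 : f 0 = 0) :
    ∃ (B : LocalNonlinearity.Hs d s → LocalNonlinearity.Hs d s)
      (B' : LocalNonlinearity.Hs d s →
        (LocalNonlinearity.L2 d →L[ℝ] LocalNonlinearity.L2 d)),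
      (∀ u, ⇑(B u).toL2 =ᵐ[volume] fun x => f (u.toL2 x)) ∧
      (∀ R : ℝ, 0 < R → ∃ K : ℝ≥0, LipschitzOnWith K B (Metric.closedBall 0 R)) ∧
      (∀ u v, ⇑(B' u v) =ᵐ[volume] fun x => fderiv ℝ f (u.toL2 x) (v x)) ∧
      (∀ R ε : ℝ, 0 < R → 0 < ε → ∃ C δ : ℝ, 0 < C ∧ 0 < δ ∧
        ∀ u w : LocalNonlinearity.Hs d s, ‖u‖ ≤ R → ‖w‖ < δ →
          ‖B' u‖ ≤ C ∧
          ‖(B (u + w)).toL2 - (B u).toL2 - B' u w.toL2‖ ≤ ε * ‖w.toL2‖) := by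
  have : Fact ((d : ℝ) / 2 < s) := ⟨hs⟩
  have hf1 : ContDiff ℝ 1 f := hf.of_le (by simp)
  obtain ⟨B, hBev, hBLip⟩ := LocalNonlinearity.Hs.exists_ev_eq_and_lipschitzOnWith d s hf hf0
  choose B' hB' using LocalNonlinearity.Hs.exists_clm_ae_eq_fderiv (d := d) (s := s) hf1
  have hB (u) : (B u).toL2 =ᵐ[volume] fun x => f (u.toL2 x) :=
    LocalNonlinearity.Hs.toL2_ae_eq_comp (hBev u)
  refine ⟨B, B', hB, fun R hR => hBLip ⟨R, hR.le⟩, hB', fun R ε _ hε => ?_⟩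
  obtain ⟨C, hC, hbound⟩ := LocalNonlinearity.Hs.exists_norm_fderiv_toL2_le d s hf1 R
  obtain ⟨δ, hδ, htaylor⟩ := LocalNonlinearity.Hs.exists_norm_toL2_sub_sub_fderiv_le d s hf1 R hε
  refine ⟨C, δ, hC, hδ, fun u w hu hw =>
    ⟨LocalNonlinearity.norm_le_of_ae_eq_apply (hB' u) hC.le (hbound u hu), ?_⟩⟩
  refine Lp.norm_le_mul_norm_of_ae_le_mul ?_
  filter_upwards [Lp.coeFn_sub ((B (u + w)).toL2 - (B u).toL2) (B' u w.toL2),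
    Lp.coeFn_sub (B (u + w)).toL2 (B u).toL2, hB u, hB (u + w), hB' u w.toL2,
    htaylor u w hu hw] with x hsub hsub' hu' huw hw' hx
  rw [hsub, Pi.sub_apply, hsub', Pi.sub_apply, huw, hu', hw']
  exact hx
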